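/- Let $\mathbb{R}_+=[0,\infty)$ and let $E_2$ be the space of $u\in L^2(\mathbb{R}_+^2)$ whose weak derivatives $u_x,u_y,u_{xy}$ on $(0,\infty)^2$ exist and lie in $L^2(\mathbb{R}_+^2)$. Functions in $E_2$ are identified with their representatives continuous on the closed quadrant $\mathbb{R}_+^2$, and point values $u(x,y)$, $(x,y)\in\mathbb{R}_+^2$, are those of this representative. For real $a,b,c,d$ put \[ J_{a,b,c,d}(u)=\int_{\mathbb{R}_+^2}\bigl(u_{xy}^2+a\,u_x^2+2b\,u_xu_y+c\,u_y^2+d\,u^2\bigr)\,dx\,dy ,\qquad u\in E_2 . \] Fix $a,c,d>0$ with $d>ac$. Then there exists $b_0>0$ (depending only on $a,c,d$) such that, for every $b\in\mathbb{R}$ with $|b|<b_0$, the functional $J_{a,b,c,d}$ has a unique minimizer on $\{u\in E_2: u(0,0)=1\}$, and this minimizer changes sign: it takes both positive and negative values on $\mathbb{R}_+^2$. -/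

import Mathlib

open MeasureTheory
open scoped ContDiff

noncomputable section

namespace EkelandNirenberg

/-- The closed quadrant `[0,∞)²`. -/
def closedQuadrant : Set (ℝ × ℝ) := {p | 0 ≤ p.1 ∧ 0 ≤ p.2}

/-- The open quadrant `(0,∞)²`. -/
def openQuadrant : Set (ℝ × ℝ) := {p | 0 < p.1 ∧ 0 < p.2}

/-- Lebesgue measure on the open quadrant. -/
def quadrantMeasure : Measure (ℝ × ℝ) := volume.restrict openQuadrant

/-- Test functions: `φ ∈ C_c^∞((0,∞)²)`, extended by zero to the plane. -/
structure IsTestFunction (φ : ℝ × ℝ → ℝ) : Prop where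
  smooth : ContDiff ℝ ∞ φ
  compact : HasCompactSupport φ
  support : tsupport φ ⊆ openQuadrant

/-- Iterated classical directional derivative of `φ` along the directions of the list. -/
def classicalDeriv : List (ℝ × ℝ) → (ℝ × ℝ → ℝ) → (ℝ × ℝ → ℝ)
  | [], φ => φ
  | e :: l, φ => fun p => fderiv ℝ (classicalDeriv l φ) p e

/-- `w ∈ L²((0,∞)²)` is the weak derivative of `u` along the directions in the list `l`:
`∫ u ∂_l φ = (-1)^|l| ∫ w φ` for all test functions `φ`. -/
def HasL2WeakDeriv (l : List (ℝ × ℝ)) (u w : ℝ × ℝ → ℝ) : Prop :=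
  MemLp w 2 quadrantMeasure ∧
    ∀ φ : ℝ × ℝ → ℝ, IsTestFunction φ →
      ∫ p, u p * classicalDeriv l φ p ∂quadrantMeasure
        = (-1) ^ l.length * ∫ p, w p * φ p ∂quadrantMeasure

/-- The directions of `∂_x`. -/
def dirX : List (ℝ × ℝ) := [(1, 0)]

/-- The directions of `∂_y`. -/
def dirY : List (ℝ × ℝ) := [(0, 1)]

/-- The directions of `∂_x ∂_y`. -/
def dirXY : List (ℝ × ℝ) := [(1, 0), (0, 1)]

/-- The mixed Sobolev space `E₂`: `u, u_x, u_y, u_xy ∈ L²((0,∞)²)`, with weak derivatives.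
Only the values of `u` on the quadrant, up to null sets, matter. -/
structure MemE2 (u : ℝ × ℝ → ℝ) : Prop where
  memLp : MemLp u 2 quadrantMeasure
  exists_x : ∃ w, HasL2WeakDeriv dirX u w
  exists_y : ∃ w, HasL2WeakDeriv dirY u w
  exists_xy : ∃ w, HasL2WeakDeriv dirXY u w

open Classical in
/-- The weak derivative in `L²` (unique up to null sets), and `0` if there is none. -/
def weakDeriv (l : List (ℝ × ℝ)) (u : ℝ × ℝ → ℝ) : ℝ × ℝ → ℝ :=
  if h : ∃ w, HasL2WeakDeriv l u w then h.choose else 0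

/-- `J_{a,b,c,d}(u) = ∫ (u_xy² + a u_x² + 2 b u_x u_y + c u_y² + d u²) dx dy`. -/
def energy (a b c d : ℝ) (u : ℝ × ℝ → ℝ) : ℝ :=
  ∫ p, ((weakDeriv dirXY u p) ^ 2 + a * (weakDeriv dirX u p) ^ 2
      + 2 * b * (weakDeriv dirX u p * weakDeriv dirY u p)
      + c * (weakDeriv dirY u p) ^ 2 + d * (u p) ^ 2) ∂quadrantMeasure

/-- `U` is a representative of `u` which is continuous on the closed quadrant. -/
def IsContinuousRep (u U : ℝ × ℝ → ℝ) : Prop :=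
  ContinuousOn U closedQuadrant ∧ u =ᵐ[quadrantMeasure] U

/-- `u ∈ E₂` and `u(0,0) = 1`, where the corner value is that of the continuous representative. -/
def Admissible (u : ℝ × ℝ → ℝ) : Prop :=
  MemE2 u ∧ ∃ U, IsContinuousRep u U ∧ U (0, 0) = 1

/-- `u` minimizes `J_{a,b,c,d}` over `{v ∈ E₂ : v(0,0) = 1}`. -/
def IsConstrainedMinimizer (a b c d : ℝ) (u : ℝ × ℝ → ℝ) : Prop :=
  Admissible u ∧ ∀ v, Admissible v → energy a b c d u ≤ energy a b c d v

/-- `U` takes both a positive and a negative value on the closed quadrant. -/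
def ChangesSign (U : ℝ × ℝ → ℝ) : Prop :=
  (∃ p ∈ closedQuadrant, 0 < U p) ∧ ∃ p ∈ closedQuadrant, U p < 0

end EkelandNirenberg

end

/-!
# Sign change of the minimizer of a mixed second-order functional on the quadrant

**Point values.** A function `u` of the mixed Sobolev space is recovered from
`g = (1 - ∂_x)(1 - ∂_y) u ∈ L²` as `u p = ∫_{q > p} e^{-(q₁ - p₁) - (q₂ - p₂)} g q dq`
(`ae_eq_cornerPotential`). This gives the continuous representative and shows that point evaluation
is a bounded functional. The space of quadruples `(u, u_x, u_y, u_xy)` is a closed subspace of a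
Hilbert space (`jetSpace`), on which the energy is a coercive quadratic form when `|b|` is small; the
unique minimizer is a positive multiple of the element `r_b` representing `u ↦ u(0,0)`. Since `r_b`
depends continuously on `b`, it suffices that `r_0` takes a negative value
(`exists_pos_forall_representer_neg`).

**The sign of `u = r_0`.** For `b = 0` the Euler-Lagrange operator is
`(-∂_x² + c)(-∂_y² + a) + k` with `k = d - a c > 0`. With `λ = √c`, let `ρ_s` be the decaying
solution of `λ² ρ - ρ'' = e^{λ x} φ_s`, `ρ'(0) = 0`, where `φ_s = -(e^{-x²/s²})'`, and let `σ_t` be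
the analogous function of `y` with `√a` in place of `√c`. Testing the equation of `u` with
`ρ_s ⊗ σ_t` gives `F s t + k P s t = M` with a constant `M > 0`, where `F` and `P` are the integrals
of `u` against the tensor products of the sources and of the solutions. Suppose that `u ≥ 0`. Then
`P ≤ M / k`, and since the sources are bounded by `C / s` times the solutions with parameter `2 s`,
`F s t ≤ C / (s t)`. The solutions increase with their parameter, so the mixed difference of `P` is
nonnegative and that of `F` is nonpositive: `F 1 1 ≤ F 1 s + F s 1`, which tends to `0` as
`s → ∞`. Hence `F 1 1 = 0` and `u = 0`, which is impossible (`exists_evalAt_neg`).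
-/

noncomputable section

namespace EkelandNirenberg

open Filter Topology

/-! ### Exponentially decaying functions on the half-line and cutoffs -/

/-- `|f x| ≤ C e^{-κ x}` on `(0,∞)` for some constant `C`; nothing is asked on `(-∞,0]`. -/
def ExpDecay (κ : ℝ) (f : ℝ → ℝ) : Prop :=
  ∃ C, ∀ x, 0 < x → |f x| ≤ C * Real.exp (-(κ * x))

lemma ExpDecay.add {κ : ℝ} {f g : ℝ → ℝ} (hf : ExpDecay κ f) (hg : ExpDecay κ g) :
    ExpDecay κ (fun x => f x + g x) := by
  obtain ⟨C, hC⟩ := hf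
  obtain ⟨D, hD⟩ := hg
  refine ⟨C + D, fun x hx => (abs_add_le _ _).trans ?_⟩
  rw [add_mul]
  exact add_le_add (hC x hx) (hD x hx)

lemma ExpDecay.const_mul {κ : ℝ} {f : ℝ → ℝ} (hf : ExpDecay κ f) (c : ℝ) :
    ExpDecay κ (fun x => c * f x) := by
  obtain ⟨C, hC⟩ := hf
  refine ⟨|c| * C, fun x hx => ?_⟩
  rw [abs_mul, mul_assoc]
  exact mul_le_mul_of_nonneg_left (hC x hx) (abs_nonneg c)

lemma ExpDecay.sub {κ : ℝ} {f g : ℝ → ℝ} (hf : ExpDecay κ f) (hg : ExpDecay κ g) :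
    ExpDecay κ (fun x => f x - g x) := by
  simpa [sub_eq_add_neg] using hf.add (hg.const_mul (-1))

lemma ExpDecay.exists_nonneg {κ : ℝ} {f : ℝ → ℝ} (hf : ExpDecay κ f) :
    ∃ C, 0 ≤ C ∧ ∀ x, 0 < x → |f x| ≤ C * Real.exp (-(κ * x)) := by
  obtain ⟨C, hC⟩ := hf
  exact ⟨|C|, abs_nonneg C, fun x hx => (hC x hx).trans
    (mul_le_mul_of_nonneg_right (le_abs_self C) (Real.exp_pos _).le)⟩

lemma hasDerivAt_of_contDiff {f : ℝ → ℝ} (hf : ContDiff ℝ ∞ f) (x : ℝ) :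
    HasDerivAt f (deriv f x) x :=
  ((hf.differentiable (by simp)) x).hasDerivAt

lemma contDiff_deriv {f : ℝ → ℝ} (hf : ContDiff ℝ ∞ f) : ContDiff ℝ ∞ (deriv f) :=
  (contDiff_infty_iff_deriv.1 hf).2

lemma contDiff_smoothTransition : ContDiff ℝ ∞ Real.smoothTransition :=
  Real.smoothTransition.contDiff

lemma deriv_smoothTransition_of_neg {x : ℝ} (hx : x < 0) : deriv Real.smoothTransition x = 0 := by
  have h : Real.smoothTransition =ᶠ[𝓝 x] fun _ => 0 := by
    filter_upwards [Iio_mem_nhds hx] with y hy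
    exact Real.smoothTransition.zero_of_nonpos (le_of_lt hy)
  rw [h.deriv_eq]; simp

lemma deriv_smoothTransition_of_one_lt {x : ℝ} (hx : 1 < x) :
    deriv Real.smoothTransition x = 0 := by
  have h : Real.smoothTransition =ᶠ[𝓝 x] fun _ => 1 := by
    filter_upwards [Ioi_mem_nhds hx] with y hy
    exact Real.smoothTransition.one_of_one_le (le_of_lt hy)
  rw [h.deriv_eq]; simp

lemma exists_bound_deriv_smoothTransition :
    ∃ D, 0 ≤ D ∧ ∀ x, |deriv Real.smoothTransition x| ≤ D := by
  have hc : Continuous (deriv Real.smoothTransition) :=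
    (contDiff_deriv contDiff_smoothTransition).continuous
  obtain ⟨D, hD⟩ := (isCompact_Icc (a := (0 : ℝ)) (b := 1)).exists_bound_of_continuousOn
    hc.continuousOn
  have hD0 : 0 ≤ D := (norm_nonneg _).trans (hD 0 (by simp))
  refine ⟨D, hD0, fun x => ?_⟩
  by_cases h0 : x < 0
  · simpa [deriv_smoothTransition_of_neg h0]
  by_cases h1 : 1 < x
  · simpa [deriv_smoothTransition_of_one_lt h1]
  exact hD x ⟨not_lt.1 h0, not_lt.1 h1⟩

/-- The cutoff which is `1` on `[2/(n+1), n+1]` and vanishes outside `[1/(n+1), n+2]`. -/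
def cutoff (n : ℕ) (x : ℝ) : ℝ :=
  Real.smoothTransition ((n + 1) * x - 1) * Real.smoothTransition (n + 2 - x)

lemma contDiff_cutoff (n : ℕ) : ContDiff ℝ ∞ (cutoff n) := by
  unfold cutoff
  exact (contDiff_smoothTransition.comp (by fun_prop)).mul
    (contDiff_smoothTransition.comp (by fun_prop))

lemma abs_cutoff_le (n : ℕ) (x : ℝ) : |cutoff n x| ≤ 1 := by
  unfold cutoff
  rw [abs_of_nonneg (mul_nonneg (Real.smoothTransition.nonneg _) (Real.smoothTransition.nonneg _))]
  exact mul_le_one₀ (Real.smoothTransition.le_one _) (Real.smoothTransition.nonneg _)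
    (Real.smoothTransition.le_one _)

lemma deriv_cutoff (n : ℕ) (x : ℝ) : deriv (cutoff n) x =
    (n + 1) * deriv Real.smoothTransition ((n + 1) * x - 1)
        * Real.smoothTransition (n + 2 - x)
      - Real.smoothTransition ((n + 1) * x - 1)
        * deriv Real.smoothTransition (n + 2 - x) := by
  have h1 : HasDerivAt (fun x : ℝ => (n + 1) * x - 1) ((n : ℝ) + 1) x := by
    simpa using ((hasDerivAt_id x).const_mul ((n : ℝ) + 1)).sub_const 1
  have h2 : HasDerivAt (fun x : ℝ => (n : ℝ) + 2 - x) (-1) x := by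
    simpa using (hasDerivAt_id x).const_sub ((n : ℝ) + 2)
  have h3 := (hasDerivAt_of_contDiff contDiff_smoothTransition ((n + 1) * x - 1)).comp x h1
  have h4 := (hasDerivAt_of_contDiff contDiff_smoothTransition (n + 2 - x)).comp x h2
  have := (h3.mul h4).deriv
  unfold cutoff
  simp only [Function.comp_def, Pi.mul_def] at this
  rw [this]; ring

lemma cutoff_eventually_eq_one {x : ℝ} (hx : 0 < x) :
    ∀ᶠ n : ℕ in atTop, ∀ᶠ y in 𝓝 x, cutoff n y = 1 := by
  obtain ⟨N, hN⟩ := exists_nat_gt (2 * (2 / x) + 2 * x)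
  filter_upwards [eventually_ge_atTop N] with n hn
  have hn' : (N : ℝ) ≤ n := by exact_mod_cast hn
  have hq : 0 < 2 / x := by positivity
  filter_upwards [Ioo_mem_nhds (show x / 2 < x by linarith) (show x < 2 * x by linarith)]
    with y hy
  have h1 : 1 ≤ ((n : ℝ) + 1) * y - 1 := by
    have h4 : 2 * (2 / x) * (x / 2) = 2 := by field_simp
    have : 2 * (2 / x) * (x / 2) ≤ ((n : ℝ) + 1) * y :=
      mul_le_mul (by linarith) hy.1.le (by linarith) (by linarith)
    linarith
  have h2 : 1 ≤ (n : ℝ) + 2 - y := by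
    have := hy.2
    linarith
  simp [cutoff, Real.smoothTransition.one_of_one_le h1, Real.smoothTransition.one_of_one_le h2]

lemma cutoff_support (n : ℕ) {x : ℝ} (hx : cutoff n x ≠ 0) :
    x ∈ Set.Icc (1 / ((n : ℝ) + 1)) (n + 2) := by
  have hn : (0 : ℝ) < n + 1 := by positivity
  constructor
  · by_contra h
    apply hx
    rw [not_le, lt_div_iff₀ hn] at h
    simp [cutoff, Real.smoothTransition.zero_of_nonpos (x := ((n : ℝ) + 1) * x - 1) (by linarith)]
  · by_contra h
    apply hx
    simp [cutoff, Real.smoothTransition.zero_of_nonpos (x := (n : ℝ) + 2 - x) (by linarith)]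

lemma tsupport_cutoff_mul (n : ℕ) (α : ℝ → ℝ) :
    tsupport (fun x => cutoff n x * α x) ⊆ Set.Icc (1 / ((n : ℝ) + 1)) (n + 2) := by
  refine closure_minimal (fun x hx => cutoff_support n fun h => hx ?_) isClosed_Icc
  simp [h]

/-- If `α 0 = 0` and `α'` decays exponentially, the derivatives of the truncations of `α` are
dominated uniformly: near `0` the factor `n + 1` from the derivative of the cutoff is compensated
by `|α x| ≤ C x` with `x ≤ 2/(n+1)`. -/
lemma exists_bound_deriv_cutoff_mul {κ : ℝ} {α : ℝ → ℝ} (hκ : 0 < κ) (hα : ContDiff ℝ ∞ α)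
    (hd : ExpDecay κ α) (hd' : ExpDecay κ (deriv α)) (h0 : α 0 = 0) :
    ∃ C, ∀ n : ℕ, ∀ x, 0 < x →
      |deriv (fun x => cutoff n x * α x) x| ≤ C * Real.exp (-(κ * x)) := by
  obtain ⟨A, hA0, hA⟩ := hd.exists_nonneg
  obtain ⟨B, hB0, hB⟩ := hd'.exists_nonneg
  obtain ⟨D, hD0, hD⟩ := exists_bound_deriv_smoothTransition
  have hlin : ∀ x, 0 < x → |α x| ≤ B * x := by
    intro x hx
    have := Convex.norm_image_sub_le_of_norm_deriv_le (f := α) (s := Set.Icc 0 x) (x := 0) (y := x)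
      (C := B) (fun y _ => (hα.differentiable (by simp)) y) (fun y hy => ?_) (convex_Icc 0 x)
      ⟨le_rfl, hx.le⟩ ⟨hx.le, le_rfl⟩
    · simpa [h0, abs_of_pos hx] using this
    · have hle : ∀ y, 0 < y → ‖deriv α y‖ ≤ B := fun y hy =>
        (hB y hy).trans (mul_le_of_le_one_right hB0 (Real.exp_le_one_iff.2 (by nlinarith)))
      rcases hy.1.eq_or_lt with h | h
      · have hcl : IsClosed {y | ‖deriv α y‖ ≤ B} :=
          isClosed_le (contDiff_deriv hα).continuous.norm continuous_const
        have : (0 : ℝ) ∈ closure (Set.Ioi (0 : ℝ)) := by simp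
        rw [← h]
        exact hcl.closure_subset_iff.2 (fun y hy => hle y hy) this
      · exact hle y h
  refine ⟨2 * B * D * Real.exp (2 * κ) + D * A + B, fun n x hx => ?_⟩
  have hn : (0 : ℝ) < n + 1 := by positivity
  have hE := Real.exp_pos (-(κ * x))
  have hder : deriv (fun x => cutoff n x * α x) x =
      deriv (cutoff n) x * α x + cutoff n x * deriv α x :=
    ((hasDerivAt_of_contDiff (contDiff_cutoff n) x).mul (hasDerivAt_of_contDiff hα x)).deriv
  have hS0 := fun y => Real.smoothTransition.nonneg y
  have hS1 := fun y => Real.smoothTransition.le_one y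
  have habs : ∀ y, |Real.smoothTransition y| ≤ 1 := fun y => by
    rw [abs_of_nonneg (hS0 y)]; exact hS1 y
  have t1 : |(n + 1) * deriv Real.smoothTransition ((n + 1) * x - 1)
        * Real.smoothTransition (n + 2 - x) * α x|
      ≤ 2 * B * D * Real.exp (2 * κ) * Real.exp (-(κ * x)) := by
    by_cases h : 1 < ((n : ℝ) + 1) * x - 1
    · rw [deriv_smoothTransition_of_one_lt h]
      simp only [mul_zero, zero_mul, abs_zero]
      positivity
    · have hx2 : ((n : ℝ) + 1) * x ≤ 2 := by linarith
      have hx2' : x ≤ 2 := by nlinarith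
      have he : 1 ≤ Real.exp (2 * κ) * Real.exp (-(κ * x)) := by
        rw [← Real.exp_add]; apply Real.one_le_exp; nlinarith
      calc _ = |deriv Real.smoothTransition ((n + 1) * x - 1)|
              * |Real.smoothTransition (n + 2 - x)| * (((n : ℝ) + 1) * |α x|) := by
            rw [abs_mul, abs_mul, abs_mul, abs_of_pos hn]; ring
        _ ≤ D * 1 * (B * 2) := by
            apply mul_le_mul _ _ (by positivity) (by positivity)
            · exact mul_le_mul (hD _) (habs _) (abs_nonneg _) hD0
            · calc ((n : ℝ) + 1) * |α x| ≤ ((n : ℝ) + 1) * (B * x) :=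
                    mul_le_mul_of_nonneg_left (hlin x hx) hn.le
                _ = B * (((n : ℝ) + 1) * x) := by ring
                _ ≤ B * 2 := mul_le_mul_of_nonneg_left hx2 hB0
        _ = 2 * B * D * 1 := by ring
        _ ≤ 2 * B * D * (Real.exp (2 * κ) * Real.exp (-(κ * x))) :=
            mul_le_mul_of_nonneg_left he (by positivity)
        _ = _ := by ring
  have t2 : |Real.smoothTransition ((n + 1) * x - 1)
        * deriv Real.smoothTransition (n + 2 - x) * α x| ≤ D * A * Real.exp (-(κ * x)) := by
    rw [abs_mul, abs_mul]
    calc _ ≤ 1 * D * (A * Real.exp (-(κ * x))) := by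
          apply mul_le_mul _ (hA x hx) (abs_nonneg _) (by positivity)
          exact mul_le_mul (habs _) (hD _) (abs_nonneg _) zero_le_one
      _ = _ := by ring
  have t3 : |cutoff n x * deriv α x| ≤ B * Real.exp (-(κ * x)) := by
    rw [abs_mul]
    calc _ ≤ 1 * (B * Real.exp (-(κ * x))) :=
          mul_le_mul (abs_cutoff_le n x) (hB x hx) (abs_nonneg _) zero_le_one
      _ = _ := by ring
  rw [hder, deriv_cutoff, sub_mul]
  refine (abs_add_le _ _).trans ?_
  have := norm_sub_le ((n + 1) * deriv Real.smoothTransition ((n + 1) * x - 1)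
        * Real.smoothTransition (n + 2 - x) * α x) (Real.smoothTransition ((n + 1) * x - 1)
        * deriv Real.smoothTransition (n + 2 - x) * α x)
  simp only [Real.norm_eq_abs] at this
  linarith

/-- Smooth, exponentially decaying functions are approximated on `(0,∞)` by test functions,
locally exactly and with a uniform exponential bound. -/
lemma exists_testFunction_approx {κ : ℝ} {α : ℝ → ℝ} (hα : ContDiff ℝ ∞ α)
    (hd : ExpDecay κ α) :
    ∃ γ : ℕ → ℝ → ℝ, (∀ n, ContDiff ℝ ∞ (γ n)) ∧ (∀ n, HasCompactSupport (γ n)) ∧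
      (∀ n, tsupport (γ n) ⊆ Set.Ioi 0) ∧
      (∀ x, 0 < x → Tendsto (fun n => γ n x) atTop (𝓝 (α x))) ∧
      (∀ x, 0 < x → Tendsto (fun n => deriv (γ n) x) atTop (𝓝 (deriv α x))) ∧
      (∃ C, ∀ n, ∀ x, 0 < x → |γ n x| ≤ C * Real.exp (-(κ * x))) ∧
      (0 < κ → α 0 = 0 → ExpDecay κ (deriv α) →
        ∃ C, ∀ n, ∀ x, 0 < x → |deriv (γ n) x| ≤ C * Real.exp (-(κ * x))) := by
  have hev : ∀ x, 0 < x → ∀ᶠ n : ℕ in atTop, (fun x => cutoff n x * α x) =ᶠ[𝓝 x] α := by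
    intro x hx
    filter_upwards [cutoff_eventually_eq_one hx] with n hn
    filter_upwards [hn] with y hy
    simp [hy]
  refine ⟨fun n x => cutoff n x * α x, fun n => (contDiff_cutoff n).mul hα, fun n => ?_,
    fun n x hx => ?_, fun x hx => ?_, fun x hx => ?_, ?_,
    fun hκ h0 hd' => exists_bound_deriv_cutoff_mul hκ hα hd hd' h0⟩
  · exact isCompact_Icc.of_isClosed_subset (isClosed_tsupport _) (tsupport_cutoff_mul n α)
  · exact lt_of_lt_of_le (by positivity) (tsupport_cutoff_mul n α hx).1
  · refine tendsto_const_nhds.congr' ?_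
    filter_upwards [hev x hx] with n hn using hn.eq_of_nhds.symm
  · refine tendsto_const_nhds.congr' ?_
    filter_upwards [hev x hx] with n hn using hn.deriv_eq.symm
  · obtain ⟨C, hC⟩ := hd
    refine ⟨C, fun n x hx => ?_⟩
    rw [abs_mul]
    exact (mul_le_of_le_one_left (abs_nonneg _) (abs_cutoff_le n x)).trans (hC x hx)

/-! ### Tensor products and integrals over the quadrant -/

/-- The tensor product `(x, y) ↦ f x * g y`. -/
def tens (f g : ℝ → ℝ) : ℝ × ℝ → ℝ := fun p => f p.1 * g p.2

lemma isOpen_openQuadrant : IsOpen openQuadrant :=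
  (isOpen_lt continuous_const continuous_fst).inter (isOpen_lt continuous_const continuous_snd)

lemma measurableSet_openQuadrant : MeasurableSet openQuadrant :=
  isOpen_openQuadrant.measurableSet

lemma ae_mem_openQuadrant : ∀ᵐ p ∂quadrantMeasure, p ∈ openQuadrant :=
  ae_restrict_mem measurableSet_openQuadrant

lemma quadrantMeasure_eq_prod : quadrantMeasure =
    (volume.restrict (Set.Ioi (0 : ℝ))).prod (volume.restrict (Set.Ioi (0 : ℝ))) := by
  rw [Measure.prod_restrict]
  rfl

lemma memLp_exp {κ μ : ℝ} (hκ : 0 < κ) (hμ : 0 < μ) :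
    MemLp (fun p : ℝ × ℝ => Real.exp (-(κ * p.1)) * Real.exp (-(μ * p.2))) 2 quadrantMeasure := by
  have h1 : ∀ {ν : ℝ}, 0 < ν →
      Integrable (fun x => Real.exp (-(ν * x)) ^ 2) (volume.restrict (Set.Ioi (0 : ℝ))) := by
    intro ν hν
    have := exp_neg_integrableOn_Ioi 0 (show 0 < 2 * ν by linarith)
    refine this.congr_fun (fun x _ => ?_) measurableSet_Ioi
    simp only [← Real.exp_nat_mul]
    congr 1; push_cast; ring
  rw [memLp_two_iff_integrable_sq (by fun_prop), quadrantMeasure_eq_prod]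
  refine ((h1 hκ).mul_prod (h1 hμ)).congr (Eventually.of_forall fun p => ?_)
  simp only [mul_pow]

lemma memLp_of_exp_bound {κ μ C : ℝ} (hκ : 0 < κ) (hμ : 0 < μ) {f : ℝ × ℝ → ℝ}
    (hf : AEStronglyMeasurable f quadrantMeasure)
    (hb : ∀ p ∈ openQuadrant, |f p| ≤ C * (Real.exp (-(κ * p.1)) * Real.exp (-(μ * p.2)))) :
    MemLp f 2 quadrantMeasure := by
  refine ((memLp_exp hκ hμ).const_mul C).mono hf ?_
  filter_upwards [ae_mem_openQuadrant] with p hp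
  exact (hb p hp).trans (le_abs_self _)

lemma tens_exp_bound {κ μ C D : ℝ} {f g : ℝ → ℝ}
    (hf : ∀ x, 0 < x → |f x| ≤ C * Real.exp (-(κ * x)))
    (hg : ∀ x, 0 < x → |g x| ≤ D * Real.exp (-(μ * x))) (p : ℝ × ℝ) (hp : p ∈ openQuadrant) :
    |tens f g p| ≤ (C * D) * (Real.exp (-(κ * p.1)) * Real.exp (-(μ * p.2))) := by
  rw [tens, abs_mul]
  calc _ ≤ (C * Real.exp (-(κ * p.1))) * (D * Real.exp (-(μ * p.2))) :=
        mul_le_mul (hf _ hp.1) (hg _ hp.2) (abs_nonneg _) ((abs_nonneg _).trans (hf _ hp.1))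
    _ = _ := by ring

lemma continuous_tens {f g : ℝ → ℝ} (hf : Continuous f) (hg : Continuous g) :
    Continuous (tens f g) := by
  unfold tens; fun_prop

lemma memLp_tens {κ μ : ℝ} (hκ : 0 < κ) (hμ : 0 < μ) {f g : ℝ → ℝ} (hf : Continuous f)
    (hg : Continuous g) (hfd : ExpDecay κ f) (hgd : ExpDecay μ g) :
    MemLp (tens f g) 2 quadrantMeasure := by
  obtain ⟨C, hC⟩ := hfd
  obtain ⟨D, hD⟩ := hgd
  exact memLp_of_exp_bound hκ hμ (continuous_tens hf hg).aestronglyMeasurable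
    (tens_exp_bound hC hD)

lemma integrable_mul_of_memLp {u v : ℝ × ℝ → ℝ} (hu : MemLp u 2 quadrantMeasure)
    (hv : MemLp v 2 quadrantMeasure) : Integrable (fun p => u p * v p) quadrantMeasure :=
  hu.integrable_mul hv

/-- Dominated convergence for the pairing of an `L²` function with functions that have a common
exponential bound. -/
lemma tendsto_integral_mul {κ μ C : ℝ} (hκ : 0 < κ) (hμ : 0 < μ) {u : ℝ × ℝ → ℝ}
    (hu : MemLp u 2 quadrantMeasure) {F : ℕ → ℝ × ℝ → ℝ} {f : ℝ × ℝ → ℝ}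
    (hF : ∀ n, Continuous (F n))
    (hb : ∀ n, ∀ p ∈ openQuadrant,
      |F n p| ≤ C * (Real.exp (-(κ * p.1)) * Real.exp (-(μ * p.2))))
    (hlim : ∀ p ∈ openQuadrant, Tendsto (fun n => F n p) atTop (𝓝 (f p))) :
    Tendsto (fun n => ∫ p, u p * F n p ∂quadrantMeasure) atTop
      (𝓝 (∫ p, u p * f p ∂quadrantMeasure)) := by
  refine tendsto_integral_of_dominated_convergence
    (fun p => |u p| * (C * (Real.exp (-(κ * p.1)) * Real.exp (-(μ * p.2)))))
    (fun n => hu.aestronglyMeasurable.mul (hF n).aestronglyMeasurable)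
    (integrable_mul_of_memLp hu.abs ((memLp_exp hκ hμ).const_mul C)) (fun n => ?_) ?_
  · filter_upwards [ae_mem_openQuadrant] with p hp
    rw [norm_mul]
    exact mul_le_mul_of_nonneg_left (hb n p hp) (norm_nonneg _)
  · filter_upwards [ae_mem_openQuadrant] with p hp
    exact (hlim p hp).const_mul _

/-! ### Classical derivatives of tensor products -/

lemma hasFDerivAt_tens {f g : ℝ → ℝ} (hf : Differentiable ℝ f) (hg : Differentiable ℝ g)
    (p : ℝ × ℝ) : HasFDerivAt (tens f g)
      (f p.1 • (deriv g p.2 • ContinuousLinearMap.snd ℝ ℝ ℝ)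
        + g p.2 • (deriv f p.1 • ContinuousLinearMap.fst ℝ ℝ ℝ)) p :=
  ((hf p.1).hasDerivAt.comp_hasFDerivAt p hasFDerivAt_fst).mul
    ((hg p.2).hasDerivAt.comp_hasFDerivAt p hasFDerivAt_snd)

lemma classicalDeriv_dirX_tens {f g : ℝ → ℝ} (hf : Differentiable ℝ f)
    (hg : Differentiable ℝ g) : classicalDeriv dirX (tens f g) = tens (deriv f) g := by
  funext p
  simp only [dirX, classicalDeriv, (hasFDerivAt_tens hf hg p).fderiv]
  simp [tens]; ring

lemma classicalDeriv_dirY_tens {f g : ℝ → ℝ} (hf : Differentiable ℝ f)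
    (hg : Differentiable ℝ g) : classicalDeriv dirY (tens f g) = tens f (deriv g) := by
  funext p
  simp only [dirY, classicalDeriv, (hasFDerivAt_tens hf hg p).fderiv]
  simp [tens]

lemma classicalDeriv_dirXY (φ : ℝ × ℝ → ℝ) :
    classicalDeriv dirXY φ = classicalDeriv dirX (classicalDeriv dirY φ) := rfl

lemma classicalDeriv_dirXY_tens {f g : ℝ → ℝ} (hf : Differentiable ℝ f)
    (hg : Differentiable ℝ g) (hg' : Differentiable ℝ (deriv g)) :
    classicalDeriv dirXY (tens f g) = tens (deriv f) (deriv g) := by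
  rw [classicalDeriv_dirXY, classicalDeriv_dirY_tens hf hg, classicalDeriv_dirX_tens hf hg']

lemma contDiff_tens {f g : ℝ → ℝ} (hf : ContDiff ℝ ∞ f) (hg : ContDiff ℝ ∞ g) :
    ContDiff ℝ ∞ (tens f g) :=
  (hf.comp contDiff_fst).mul (hg.comp contDiff_snd)

lemma isTestFunction_tens {f g : ℝ → ℝ} (hf : ContDiff ℝ ∞ f) (hg : ContDiff ℝ ∞ g)
    (hfc : HasCompactSupport f) (hgc : HasCompactSupport g) (hfs : tsupport f ⊆ Set.Ioi 0)
    (hgs : tsupport g ⊆ Set.Ioi 0) : IsTestFunction (tens f g) := by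
  have hsub : tsupport (tens f g) ⊆ tsupport f ×ˢ tsupport g := by
    refine closure_minimal (fun p hp => ?_) ((isClosed_tsupport f).prod (isClosed_tsupport g))
    have hp' : f p.1 * g p.2 ≠ 0 := hp
    exact ⟨subset_tsupport f (left_ne_zero_of_mul hp'),
      subset_tsupport g (right_ne_zero_of_mul hp')⟩
  exact ⟨contDiff_tens hf hg,
    (hfc.isCompact.prod hgc.isCompact).of_isClosed_subset (isClosed_tsupport _) hsub,
    fun p hp => ⟨hfs (hsub hp).1, hgs (hsub hp).2⟩⟩

/-! ### Integration by parts against non-compactly supported tensor products -/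

section IntegrationByParts

variable {κ μ : ℝ} {u w : ℝ × ℝ → ℝ} {α β : ℝ → ℝ}

lemma differentiable_of_contDiff {f : ℝ → ℝ} (hf : ContDiff ℝ ∞ f) : Differentiable ℝ f :=
  hf.differentiable (by simp)

/-- The defining identity of `u_x` holds for `α ⊗ β` as soon as `α` vanishes at `0`. -/
lemma HasL2WeakDeriv.integral_tens_dirX (h : HasL2WeakDeriv dirX u w)
    (hu : MemLp u 2 quadrantMeasure) (hκ : 0 < κ) (hμ : 0 < μ)
    (hα : ContDiff ℝ ∞ α) (hβ : ContDiff ℝ ∞ β) (hαd : ExpDecay κ α)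
    (hαd' : ExpDecay κ (deriv α)) (hβd : ExpDecay μ β) (hα0 : α 0 = 0) :
    ∫ p, w p * tens α β p ∂quadrantMeasure
      = -∫ p, u p * tens (deriv α) β p ∂quadrantMeasure := by
  obtain ⟨γ, hγ, hγc, hγs, hγl, hγl', ⟨C, hC⟩, hC'⟩ := exists_testFunction_approx hα hαd
  obtain ⟨C', hC'⟩ := hC' hκ hα0 hαd'
  obtain ⟨δ, hδ, hδc, hδs, hδl, -, ⟨D, hD⟩, -⟩ := exists_testFunction_approx hβ hβd
  have h1 := tendsto_integral_mul (F := fun n => tens (γ n) (δ n)) (f := tens α β) hκ hμ h.1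
    (fun n => continuous_tens (hγ n).continuous (hδ n).continuous)
    (fun n => tens_exp_bound (hC n) (hD n))
    (fun p hp => (hγl _ hp.1).mul (hδl _ hp.2))
  have h2 := tendsto_integral_mul (F := fun n => tens (deriv (γ n)) (δ n))
    (f := tens (deriv α) β) hκ hμ hu
    (fun n => continuous_tens (contDiff_deriv (hγ n)).continuous (hδ n).continuous)
    (fun n => tens_exp_bound (hC' n) (hD n))
    (fun p hp => (hγl' _ hp.1).mul (hδl _ hp.2))
  refine tendsto_nhds_unique h1 (h2.neg.congr fun n => ?_)
  have := h.2 _ (isTestFunction_tens (hγ n) (hδ n) (hγc n) (hδc n) (hγs n) (hδs n))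
  rw [classicalDeriv_dirX_tens (differentiable_of_contDiff (hγ n))
    (differentiable_of_contDiff (hδ n))] at this
  rw [this]; simp [dirX]

/-- The defining identity of `u_y` holds for `α ⊗ β` as soon as `β` vanishes at `0`. -/
lemma HasL2WeakDeriv.integral_tens_dirY (h : HasL2WeakDeriv dirY u w)
    (hu : MemLp u 2 quadrantMeasure) (hκ : 0 < κ) (hμ : 0 < μ)
    (hα : ContDiff ℝ ∞ α) (hβ : ContDiff ℝ ∞ β) (hαd : ExpDecay κ α)
    (hβd : ExpDecay μ β) (hβd' : ExpDecay μ (deriv β)) (hβ0 : β 0 = 0) :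
    ∫ p, w p * tens α β p ∂quadrantMeasure
      = -∫ p, u p * tens α (deriv β) p ∂quadrantMeasure := by
  obtain ⟨γ, hγ, hγc, hγs, hγl, -, ⟨C, hC⟩, -⟩ := exists_testFunction_approx hα hαd
  obtain ⟨δ, hδ, hδc, hδs, hδl, hδl', ⟨D, hD⟩, hD'⟩ := exists_testFunction_approx hβ hβd
  obtain ⟨D', hD'⟩ := hD' hμ hβ0 hβd'
  have h1 := tendsto_integral_mul (F := fun n => tens (γ n) (δ n)) (f := tens α β) hκ hμ h.1
    (fun n => continuous_tens (hγ n).continuous (hδ n).continuous)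
    (fun n => tens_exp_bound (hC n) (hD n))
    (fun p hp => (hγl _ hp.1).mul (hδl _ hp.2))
  have h2 := tendsto_integral_mul (F := fun n => tens (γ n) (deriv (δ n)))
    (f := tens α (deriv β)) hκ hμ hu
    (fun n => continuous_tens (hγ n).continuous (contDiff_deriv (hδ n)).continuous)
    (fun n => tens_exp_bound (hC n) (hD' n))
    (fun p hp => (hγl _ hp.1).mul (hδl' _ hp.2))
  refine tendsto_nhds_unique h1 (h2.neg.congr fun n => ?_)
  have := h.2 _ (isTestFunction_tens (hγ n) (hδ n) (hγc n) (hδc n) (hγs n) (hδs n))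
  rw [classicalDeriv_dirY_tens (differentiable_of_contDiff (hγ n))
    (differentiable_of_contDiff (hδ n))] at this
  rw [this]; simp [dirY]

/-- The defining identity of `u_xy` holds for `α ⊗ β` as soon as `α` and `β` vanish at `0`. -/
lemma HasL2WeakDeriv.integral_tens_dirXY (h : HasL2WeakDeriv dirXY u w)
    (hu : MemLp u 2 quadrantMeasure) (hκ : 0 < κ) (hμ : 0 < μ)
    (hα : ContDiff ℝ ∞ α) (hβ : ContDiff ℝ ∞ β) (hαd : ExpDecay κ α)
    (hαd' : ExpDecay κ (deriv α)) (hβd : ExpDecay μ β) (hβd' : ExpDecay μ (deriv β))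
    (hα0 : α 0 = 0) (hβ0 : β 0 = 0) :
    ∫ p, w p * tens α β p ∂quadrantMeasure
      = ∫ p, u p * tens (deriv α) (deriv β) p ∂quadrantMeasure := by
  obtain ⟨γ, hγ, hγc, hγs, hγl, hγl', ⟨C, hC⟩, hC'⟩ := exists_testFunction_approx hα hαd
  obtain ⟨C', hC'⟩ := hC' hκ hα0 hαd'
  obtain ⟨δ, hδ, hδc, hδs, hδl, hδl', ⟨D, hD⟩, hD'⟩ := exists_testFunction_approx hβ hβd
  obtain ⟨D', hD'⟩ := hD' hμ hβ0 hβd'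
  have h1 := tendsto_integral_mul (F := fun n => tens (γ n) (δ n)) (f := tens α β) hκ hμ h.1
    (fun n => continuous_tens (hγ n).continuous (hδ n).continuous)
    (fun n => tens_exp_bound (hC n) (hD n))
    (fun p hp => (hγl _ hp.1).mul (hδl _ hp.2))
  have h2 := tendsto_integral_mul (F := fun n => tens (deriv (γ n)) (deriv (δ n)))
    (f := tens (deriv α) (deriv β)) hκ hμ hu
    (fun n => continuous_tens (contDiff_deriv (hγ n)).continuous
      (contDiff_deriv (hδ n)).continuous)
    (fun n => tens_exp_bound (hC' n) (hD' n))
    (fun p hp => (hγl' _ hp.1).mul (hδl' _ hp.2))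
  refine tendsto_nhds_unique h1 (h2.congr fun n => ?_)
  have := h.2 _ (isTestFunction_tens (hγ n) (hδ n) (hγc n) (hδc n) (hγs n) (hδs n))
  rw [classicalDeriv_dirXY_tens (differentiable_of_contDiff (hγ n))
    (differentiable_of_contDiff (hδ n))
    (differentiable_of_contDiff (contDiff_deriv (hδ n)))] at this
  rw [this]; simp [dirXY]

end IntegrationByParts

/-! ### Smoothed step functions and one-sided mollifiers -/

/-- A smooth step: `0` on `(-∞, a]` and `1` on `[a + 1/(n+1), ∞)`. Its derivative is a one-sided
mollifier at `a`. -/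
def step (n : ℕ) (a x : ℝ) : ℝ := Real.smoothTransition ((n + 1) * (x - a))

lemma contDiff_step (n : ℕ) (a : ℝ) : ContDiff ℝ ∞ (step n a) := by
  unfold step
  exact contDiff_smoothTransition.comp (by fun_prop)

lemma deriv_step (n : ℕ) (a x : ℝ) :
    deriv (step n a) x = (n + 1) * deriv Real.smoothTransition ((n + 1) * (x - a)) := by
  have h1 : HasDerivAt (fun x : ℝ => ((n : ℝ) + 1) * (x - a)) ((n : ℝ) + 1) x := by
    simpa using ((hasDerivAt_id x).sub_const a).const_mul ((n : ℝ) + 1)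
  have h3 := ((hasDerivAt_of_contDiff contDiff_smoothTransition ((n + 1) * (x - a))).comp x h1)
  have := h3.deriv
  simp only [Function.comp_def] at this
  unfold step
  rw [this]; ring

lemma deriv_step_ne_zero {n : ℕ} {a x : ℝ} (h : deriv (step n a) x ≠ 0) :
    x ∈ Set.Icc a (a + 1 / (n + 1)) := by
  have hn : (0 : ℝ) < n + 1 := by positivity
  rw [deriv_step] at h
  constructor
  · by_contra hx
    exact h (by rw [deriv_smoothTransition_of_neg (by nlinarith), mul_zero])
  · by_contra hx
    have : 1 / ((n : ℝ) + 1) < x - a := by linarith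
    rw [div_lt_iff₀ hn] at this
    exact h (by rw [deriv_smoothTransition_of_one_lt (by linarith), mul_zero])

lemma hasCompactSupport_deriv_step (n : ℕ) (a : ℝ) : HasCompactSupport (deriv (step n a)) :=
  isCompact_Icc.of_isClosed_subset (isClosed_tsupport _)
    (closure_minimal (fun _ hx => deriv_step_ne_zero hx) isClosed_Icc)

lemma step_of_le {n : ℕ} {a x : ℝ} (h : x ≤ a) : step n a x = 0 :=
  Real.smoothTransition.zero_of_nonpos
    (mul_nonpos_of_nonneg_of_nonpos (by positivity) (by linarith))

lemma tendsto_step {a x : ℝ} (h : a < x) : Tendsto (fun n => step n a x) atTop (𝓝 1) := by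
  obtain ⟨N, hN⟩ := exists_nat_gt (1 / (x - a))
  refine tendsto_const_nhds.congr' ?_
  filter_upwards [eventually_ge_atTop N] with n hn
  have hn' : (N : ℝ) ≤ n := by exact_mod_cast hn
  refine (Real.smoothTransition.one_of_one_le ?_).symm
  rw [div_lt_iff₀ (by linarith)] at hN
  nlinarith

lemma abs_step_le (n : ℕ) (a x : ℝ) : |step n a x| ≤ 1 := by
  unfold step
  rw [abs_of_nonneg (Real.smoothTransition.nonneg _)]
  exact Real.smoothTransition.le_one _

lemma integral_deriv_step (n : ℕ) (a : ℝ) : ∫ x, deriv (step n a) x = 1 := by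
  have hn : (0 : ℝ) < n + 1 := by positivity
  have h := integral_of_hasDerivAt_of_tendsto (f := step n a) (f' := deriv (step n a))
    (m := 0) (n := 1) (fun x => hasDerivAt_of_contDiff (contDiff_step n a) x)
    ((contDiff_deriv (contDiff_step n a)).continuous.integrable_of_hasCompactSupport
      (hasCompactSupport_deriv_step n a)) ?_ ?_
  · simpa using h
  · refine tendsto_const_nhds.congr' ?_
    filter_upwards [eventually_le_atBot a] with x hx using (step_of_le hx).symm
  · refine tendsto_const_nhds.congr' ?_
    filter_upwards [eventually_ge_atTop (a + 1 / (n + 1))] with x hx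
    refine (Real.smoothTransition.one_of_one_le ?_).symm
    have : 1 / ((n : ℝ) + 1) ≤ x - a := by linarith
    rw [div_le_iff₀ hn] at this
    linarith

lemma hasCompactSupport_tens {f g : ℝ → ℝ} (hf : HasCompactSupport f)
    (hg : HasCompactSupport g) : HasCompactSupport (tens f g) := by
  refine (hf.isCompact.prod hg.isCompact).of_isClosed_subset (isClosed_tsupport _)
    (closure_minimal (fun p hp => ?_) ((isClosed_tsupport f).prod (isClosed_tsupport g)))
  have hp' : f p.1 * g p.2 ≠ 0 := hp
  exact ⟨subset_tsupport f (left_ne_zero_of_mul hp'),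
      subset_tsupport g (right_ne_zero_of_mul hp')⟩

/-- Averages against the one-sided tensor mollifiers converge at Lebesgue points; the squares
carrying the mollifiers are comparable to the balls of the sup metric of `ℝ × ℝ`. -/
lemma ae_tendsto_integral_mul_step {h : ℝ × ℝ → ℝ} (hh : LocallyIntegrable h volume) :
    ∀ᵐ p : ℝ × ℝ, Tendsto (fun n : ℕ =>
      ∫ q, h q * tens (deriv (step n p.1)) (deriv (step n p.2)) q) atTop (𝓝 (h p)) := by
  obtain ⟨D, hD0, hD⟩ := exists_bound_deriv_smoothTransition
  filter_upwards [IsUnifLocDoublingMeasure.ae_tendsto_average_norm_sub volume hh 1] with p hp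
  have hδ : Tendsto (fun n : ℕ => 1 / ((n : ℝ) + 1)) atTop (𝓝[>] 0) :=
    tendsto_nhdsWithin_iff.2 ⟨tendsto_one_div_add_atTop_nhds_zero_nat,
      Eventually.of_forall fun n => by simp only [Set.mem_Ioi]; positivity⟩
  have havg := hp (fun _ => p) _ hδ (Eventually.of_forall fun n =>
    Metric.mem_closedBall_self (by positivity))
  have hlim := havg.const_mul (4 * D ^ 2)
  rw [mul_zero] at hlim
  rw [tendsto_iff_norm_sub_tendsto_zero]
  refine squeeze_zero (fun _ => norm_nonneg _) (fun n => ?_) hlim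
  set K := tens (deriv (step n p.1)) (deriv (step n p.2)) with hK
  have hn : (0 : ℝ) < n + 1 := by positivity
  have hKc : Continuous K := continuous_tens (contDiff_deriv (contDiff_step n p.1)).continuous
    (contDiff_deriv (contDiff_step n p.2)).continuous
  have hKs : HasCompactSupport K := hasCompactSupport_tens (hasCompactSupport_deriv_step n p.1)
    (hasCompactSupport_deriv_step n p.2)
  have hK1 : ∫ q, K q = 1 := by
    have := integral_prod_mul (μ := (volume : Measure ℝ)) (ν := (volume : Measure ℝ))
      (deriv (step n p.1)) (deriv (step n p.2))
    rw [integral_deriv_step, integral_deriv_step, one_mul] at this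
    exact this
  have hi1 : Integrable (fun q => h q * K q) :=
    hh.integrable_smul_right_of_hasCompactSupport hKc hKs
  have hi2 : Integrable (fun q => h p * K q) :=
    (hKc.integrable_of_hasCompactSupport hKs).const_mul _
  have heq : (∫ q, h q * K q) - h p = ∫ q, (h q - h p) * K q := by
    simp_rw [sub_mul]
    rw [integral_sub hi1 hi2, integral_const_mul, hK1, mul_one]
  have hloc : IntegrableOn (fun q => ‖h q - h p‖) (Metric.closedBall p (1 / ((n : ℝ) + 1))) :=
    ((hh.integrableOn_isCompact (isCompact_closedBall _ _)).sub
      (integrableOn_const (isCompact_closedBall _ _).measure_lt_top.ne)).norm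
  have hbound : ∀ q, ‖(h q - h p) * K q‖ ≤
      (Metric.closedBall p (1 / ((n : ℝ) + 1))).indicator
        (fun q => (((n : ℝ) + 1) * D) ^ 2 * ‖h q - h p‖) q := by
    intro q
    by_cases hq : K q = 0
    · rw [hq, mul_zero, norm_zero]
      exact Set.indicator_nonneg (fun _ _ => by positivity) _
    · have hq1 : deriv (step n p.1) q.1 ≠ 0 := left_ne_zero_of_mul hq
      have hq2 : deriv (step n p.2) q.2 ≠ 0 := right_ne_zero_of_mul hq
      have h1 := deriv_step_ne_zero hq1
      have h2 := deriv_step_ne_zero hq2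
      have hpos : 0 < 1 / ((n : ℝ) + 1) := by positivity
      have hmem : q ∈ Metric.closedBall p (1 / ((n : ℝ) + 1)) := by
        rw [Metric.mem_closedBall, Prod.dist_eq, Real.dist_eq, Real.dist_eq]
        refine max_le ?_ ?_ <;> rw [abs_le] <;> constructor <;>
          [linarith [h1.1]; linarith [h1.2]; linarith [h2.1]; linarith [h2.2]]
      rw [Set.indicator_of_mem hmem, norm_mul, mul_comm]
      refine mul_le_mul_of_nonneg_right ?_ (norm_nonneg _)
      have hs : ∀ a x, |deriv (step n a) x| ≤ ((n : ℝ) + 1) * D := fun a x => by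
        rw [deriv_step, abs_mul, abs_of_pos hn]
        exact mul_le_mul_of_nonneg_left (hD _) hn.le
      rw [hK, tens, Real.norm_eq_abs, abs_mul, sq]
      exact mul_le_mul (hs _ _) (hs _ _) (abs_nonneg _) (by positivity)
  have hvol : (volume : Measure (ℝ × ℝ)).real (Metric.closedBall p (1 / ((n : ℝ) + 1)))
      = (2 * (1 / ((n : ℝ) + 1))) ^ 2 := by
    rw [← closedBall_prod_same, Measure.real, Measure.volume_eq_prod, Measure.prod_prod,
      Real.volume_closedBall, Real.volume_closedBall, ENNReal.toReal_mul,
      ENNReal.toReal_ofReal (by positivity), sq]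
  rw [heq]
  refine (norm_integral_le_of_norm_le (IntegrableOn.integrable_indicator (hloc.const_mul _)
    measurableSet_closedBall) (Eventually.of_forall hbound)).trans (le_of_eq ?_)
  rw [integral_indicator measurableSet_closedBall, integral_const_mul, setAverage_eq, hvol,
    smul_eq_mul]
  field_simp
  ring

lemma integral_linComb {f₁ f₂ f₃ f₄ : ℝ × ℝ → ℝ} {m : Measure (ℝ × ℝ)} (h₁ : Integrable f₁ m)
    (h₂ : Integrable f₂ m) (h₃ : Integrable f₃ m) (h₄ : Integrable f₄ m) (c₁ c₂ c₃ c₄ : ℝ) :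
    ∫ p, (c₁ * f₁ p + c₂ * f₂ p + c₃ * f₃ p + c₄ * f₄ p) ∂m =
      c₁ * ∫ p, f₁ p ∂m + c₂ * ∫ p, f₂ p ∂m + c₃ * ∫ p, f₃ p ∂m + c₄ * ∫ p, f₄ p ∂m := by
  have i₁ := h₁.const_mul c₁
  have i₂ := h₂.const_mul c₂
  have i₃ := h₃.const_mul c₃
  have i₄ := h₄.const_mul c₄
  have i₁₂ : Integrable (fun p => c₁ * f₁ p + c₂ * f₂ p) m := i₁.add i₂
  have i₁₂₃ : Integrable (fun p => c₁ * f₁ p + c₂ * f₂ p + c₃ * f₃ p) m := i₁₂.add i₃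
  rw [integral_add i₁₂₃ i₄, integral_add i₁₂ i₃, integral_add i₁ i₂]
  simp only [integral_const_mul]

/-! ### The continuous representative -/

/-- The kernel `1_{q > p} e^{-(q₁ - p₁) - (q₂ - p₂)}`: the fundamental solution of
`(1 - ∂_x)(1 - ∂_y)` which is supported in `p ≤ q`. -/
def cornerKernel (p q : ℝ × ℝ) : ℝ :=
  if p.1 < q.1 ∧ p.2 < q.2 then Real.exp (p.1 - q.1) * Real.exp (p.2 - q.2) else 0

/-- The function `p ↦ ∫_{q > p} e^{-(q₁ - p₁) - (q₂ - p₂)} g q dq`. -/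
def cornerPotential (g : ℝ × ℝ → ℝ) (p : ℝ × ℝ) : ℝ :=
  ∫ q, g q * cornerKernel p q ∂quadrantMeasure

lemma measurable_cornerKernel (p : ℝ × ℝ) : Measurable (cornerKernel p) := by
  unfold cornerKernel
  refine Measurable.ite ?_ (by fun_prop) measurable_const
  exact (measurableSet_lt measurable_const measurable_fst).inter
    (measurableSet_lt measurable_const measurable_snd)

lemma abs_cornerKernel_le (p q : ℝ × ℝ) : |cornerKernel p q| ≤
    Real.exp (p.1 + p.2) * (Real.exp (-(1 * q.1)) * Real.exp (-(1 * q.2))) := by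
  unfold cornerKernel
  split_ifs
  · rw [abs_of_pos (by positivity)]
    simp only [← Real.exp_add]
    apply le_of_eq
    congr 1; ring
  · rw [abs_zero]; positivity

lemma memLp_cornerKernel (p : ℝ × ℝ) : MemLp (cornerKernel p) 2 quadrantMeasure :=
  memLp_of_exp_bound one_pos one_pos (measurable_cornerKernel p).aestronglyMeasurable
    (fun q _ => abs_cornerKernel_le p q)

lemma ae_quadrant_ne (p : ℝ × ℝ) : ∀ᵐ q ∂quadrantMeasure, q.1 ≠ p.1 ∧ q.2 ≠ p.2 := by
  refine ae_restrict_of_ae ?_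
  rw [Measure.volume_eq_prod]
  refine Filter.Eventually.and ?_ ?_
  · exact Measure.quasiMeasurePreserving_fst.ae (Measure.ae_ne volume p.1)
  · exact Measure.quasiMeasurePreserving_snd.ae (Measure.ae_ne volume p.2)

lemma continuous_cornerPotential {g : ℝ × ℝ → ℝ} (hg : MemLp g 2 quadrantMeasure) :
    Continuous (cornerPotential g) := by
  rw [continuous_iff_continuousAt]
  intro p
  unfold cornerPotential
  refine continuousAt_of_dominated (bound := fun q => |g q| * (Real.exp (p.1 + p.2 + 1)
      * (Real.exp (-(1 * q.1)) * Real.exp (-(1 * q.2)))))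
    (Eventually.of_forall fun p' => hg.aestronglyMeasurable.mul
      (measurable_cornerKernel p').aestronglyMeasurable) ?_
    (integrable_mul_of_memLp hg.abs ((memLp_exp one_pos one_pos).const_mul _)) ?_
  · have : ∀ᶠ p' : ℝ × ℝ in 𝓝 p, p'.1 + p'.2 < p.1 + p.2 + 1 :=
      (continuous_fst.add continuous_snd).continuousAt.eventually_lt continuousAt_const
        (by simp)
    filter_upwards [this] with p' hp'
    refine Eventually.of_forall fun q => ?_
    rw [norm_mul]
    refine mul_le_mul_of_nonneg_left ((abs_cornerKernel_le p' q).trans ?_) (norm_nonneg _)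
    exact mul_le_mul_of_nonneg_right (Real.exp_le_exp.2 hp'.le) (by positivity)
  · filter_upwards [ae_quadrant_ne p] with q hq
    refine continuousAt_const.mul ?_
    have hc : Continuous fun p' : ℝ × ℝ => Real.exp (p'.1 - q.1) * Real.exp (p'.2 - q.2) := by
      fun_prop
    rcases lt_or_gt_of_ne hq.1 with h1 | h1
    · refine continuousAt_const.congr (f := fun _ => (0 : ℝ)) ?_
      filter_upwards [continuous_fst.continuousAt.eventually_const_lt h1] with p' hp'
      simp [cornerKernel, not_lt.2 (le_of_lt hp')]
    rcases lt_or_gt_of_ne hq.2 with h2 | h2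
    · refine continuousAt_const.congr (f := fun _ => (0 : ℝ)) ?_
      filter_upwards [continuous_snd.continuousAt.eventually_const_lt h2] with p' hp'
      simp [cornerKernel, not_lt.2 (le_of_lt hp')]
    refine hc.continuousAt.congr ?_
    filter_upwards [continuous_fst.continuousAt.eventually_lt_const h1,
      continuous_snd.continuousAt.eventually_lt_const h2] with p' h1' h2'
    simp [cornerKernel, h1', h2']

/-- Functions which are continuous on the closed quadrant and agree almost everywhere agree
everywhere on it. -/
lemma eqOn_closedQuadrant {V W : ℝ × ℝ → ℝ} (hV : ContinuousOn V closedQuadrant)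
    (hW : ContinuousOn W closedQuadrant) (h : V =ᵐ[quadrantMeasure] W) :
    Set.EqOn V W closedQuadrant := by
  have hsub : openQuadrant ⊆ closedQuadrant := fun p hp => ⟨hp.1.le, hp.2.le⟩
  have ho : Set.EqOn V W openQuadrant :=
    Measure.eqOn_open_of_ae_eq h isOpen_openQuadrant (hV.mono hsub) (hW.mono hsub)
  refine ho.of_subset_closure hV hW hsub ?_
  have : openQuadrant = Set.Ioi (0 : ℝ) ×ˢ Set.Ioi (0 : ℝ) := rfl
  rw [this, closure_prod_eq, closure_Ioi]
  exact fun p hp => hp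

/-- Every function in the mixed Sobolev space is the corner potential of
`u - u_x - u_y + u_xy = (1 - ∂_x)(1 - ∂_y) u`. In the weak identities the corner kernel is
approximated by smoothed steps times exponentials; the other side then converges at Lebesgue
points of `u`. -/
theorem ae_eq_cornerPotential {u wx wy wxy : ℝ × ℝ → ℝ} (hu : MemLp u 2 quadrantMeasure)
    (hx : HasL2WeakDeriv dirX u wx) (hy : HasL2WeakDeriv dirY u wy)
    (hxy : HasL2WeakDeriv dirXY u wxy) :
    u =ᵐ[quadrantMeasure] cornerPotential (fun q => u q - wx q - wy q + wxy q) := by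
  set g : ℝ × ℝ → ℝ := fun q => u q - wx q - wy q + wxy q with hg
  have hgL : MemLp g 2 quadrantMeasure := ((hu.sub hx.1).sub hy.1).add hxy.1
  set E : ℝ × ℝ → ℝ := fun q => Real.exp (-q.1) * Real.exp (-q.2) with hE
  have hEc : Continuous E := by fun_prop
  set v := openQuadrant.indicator u with hv
  have hvL : LocallyIntegrable v volume := by
    have : MemLp v 2 volume := (memLp_indicator_iff_restrict measurableSet_openQuadrant).2 hu
    exact this.locallyIntegrable (by norm_num)
  have hvE : LocallyIntegrable (fun q => v q * E q) volume := by
    rw [← locallyIntegrableOn_univ] at hvL ⊢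
    exact hvL.mul_continuousOn hEc.continuousOn isClosed_univ.isLocallyClosed
  have hleb := ae_restrict_of_ae (s := openQuadrant) (ae_tendsto_integral_mul_step hvE)
  filter_upwards [ae_mem_openQuadrant, hleb] with p hp hpl
  -- the factors `α` of the test tensors; they satisfy `α + α' = step' * exp (-x)`
  let α : ℕ → ℝ → ℝ → ℝ := fun n a x => step n a x * Real.exp (-x)
  have hα : ∀ n a, ContDiff ℝ ∞ (α n a) := fun n a =>
    (contDiff_step n a).mul (Real.contDiff_exp.comp contDiff_neg)
  have hα' : ∀ n a x, deriv (α n a) x = deriv (step n a) x * Real.exp (-x) - α n a x := by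
    intro n a x
    have := ((hasDerivAt_of_contDiff (contDiff_step n a) x).mul (hasDerivAt_neg x).exp).deriv
    refine Eq.trans this ?_
    simp only [α]; ring
  have hαb : ∀ n a x, 0 < x → |α n a x| ≤ 1 * Real.exp (-(1 * x)) := fun n a x _ => by
    simp only [α]
    rw [abs_mul, abs_of_pos (Real.exp_pos _), one_mul x]
    exact mul_le_mul_of_nonneg_right (abs_step_le n a x) (Real.exp_pos _).le
  have hαd : ∀ n a, ExpDecay 1 (α n a) := fun n a => ⟨1, hαb n a⟩
  have hαd' : ∀ n a, ExpDecay 1 (deriv (α n a)) := fun n a => by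
    have h1 : ExpDecay 1 (fun x => deriv (step n a) x * Real.exp (-x)) := by
      obtain ⟨C, hC⟩ := (hasCompactSupport_deriv_step n a).exists_bound_of_continuous
        (contDiff_deriv (contDiff_step n a)).continuous
      refine ⟨C, fun x _ => ?_⟩
      rw [abs_mul, abs_of_pos (Real.exp_pos _), one_mul x]
      exact mul_le_mul_of_nonneg_right (hC x) (Real.exp_pos _).le
    have := h1.sub (hαd n a)
    rwa [← funext (hα' n a)] at this
  have hα0 : ∀ n a, 0 < a → α n a 0 = 0 := fun n a ha => by
    simp [α, step_of_le ha.le]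
  have hid : ∀ n, ∫ q, g q * tens (α n p.1) (α n p.2) q ∂quadrantMeasure =
      ∫ q, v q * E q * tens (deriv (step n p.1)) (deriv (step n p.2)) q := by
    intro n
    have cα := (hα n p.1).continuous
    have cβ := (hα n p.2).continuous
    have cα' := (contDiff_deriv (hα n p.1)).continuous
    have cβ' := (contDiff_deriv (hα n p.2)).continuous
    have m0 := memLp_tens one_pos one_pos cα cβ (hαd n _) (hαd n _)
    have m1 := memLp_tens one_pos one_pos cα' cβ (hαd' n _) (hαd n _)
    have m2 := memLp_tens one_pos one_pos cα cβ' (hαd n _) (hαd' n _)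
    have m3 := memLp_tens one_pos one_pos cα' cβ' (hαd' n _) (hαd' n _)
    have e1 := hx.integral_tens_dirX hu one_pos one_pos (hα n p.1) (hα n p.2) (hαd n _)
      (hαd' n _) (hαd n _) (hα0 n _ hp.1)
    have e2 := hy.integral_tens_dirY hu one_pos one_pos (hα n p.1) (hα n p.2) (hαd n _)
      (hαd n _) (hαd' n _) (hα0 n _ hp.2)
    have e3 := hxy.integral_tens_dirXY hu one_pos one_pos (hα n p.1) (hα n p.2) (hαd n _)
      (hαd' n _) (hαd n _) (hαd' n _) (hα0 n _ hp.1) (hα0 n _ hp.2)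
    have i0 := integrable_mul_of_memLp hu m0
    have i1 := integrable_mul_of_memLp hx.1 m0
    have i2 := integrable_mul_of_memLp hy.1 m0
    have i3 := integrable_mul_of_memLp hxy.1 m0
    have j1 := integrable_mul_of_memLp hu m1
    have j2 := integrable_mul_of_memLp hu m2
    have j3 := integrable_mul_of_memLp hu m3
    have hl : ∫ q, g q * tens (α n p.1) (α n p.2) q ∂quadrantMeasure =
        ∫ q, u q * tens (α n p.1) (α n p.2) q ∂quadrantMeasure
        + ∫ q, u q * tens (deriv (α n p.1)) (α n p.2) q ∂quadrantMeasure
        + ∫ q, u q * tens (α n p.1) (deriv (α n p.2)) q ∂quadrantMeasure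
        + ∫ q, u q * tens (deriv (α n p.1)) (deriv (α n p.2)) q ∂quadrantMeasure := by
      have := integral_linComb i0 i1 i2 i3 1 (-1) (-1) 1
      rw [e1, e2, e3] at this
      refine Eq.trans (integral_congr_ae (Eventually.of_forall fun q => ?_)) (this.trans ?_)
      · simp only [hg]; ring
      · ring
    rw [hl]
    have hs := integral_linComb i0 j1 j2 j3 1 1 1 1
    simp only [one_mul] at hs
    rw [← hs]
    have hr : ∀ q, v q * E q * tens (deriv (step n p.1)) (deriv (step n p.2)) q =
        openQuadrant.indicator
          (fun q => u q * E q * tens (deriv (step n p.1)) (deriv (step n p.2)) q) q := by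
      intro q
      by_cases hq : q ∈ openQuadrant <;> simp [hv, hq]
    simp_rw [hr]
    rw [integral_indicator measurableSet_openQuadrant]
    refine integral_congr_ae (Eventually.of_forall fun q => ?_)
    simp only [tens, hα', hE]
    ring
  have hlim : Tendsto (fun n => ∫ q, g q * tens (α n p.1) (α n p.2) q ∂quadrantMeasure) atTop
      (𝓝 (∫ q, g q * E p * cornerKernel p q ∂quadrantMeasure)) := by
    simp_rw [mul_assoc (g _)]
    refine tendsto_integral_mul one_pos one_pos hgL
      (fun n => continuous_tens (hα n p.1).continuous (hα n p.2).continuous)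
      (fun n => tens_exp_bound (hαb n p.1) (hαb n p.2)) (fun q hq => ?_)
    by_cases h : p.1 < q.1 ∧ p.2 < q.2
    · have h1 := ((tendsto_step h.1).mul_const (Real.exp (-q.1))).mul
        ((tendsto_step h.2).mul_const (Real.exp (-q.2)))
      refine h1.trans (le_of_eq ?_)
      congr 1
      simp only [cornerKernel, h, hE, and_self, if_true, ← Real.exp_add, one_mul]
      congr 1; ring
    · rw [cornerKernel, if_neg h, mul_zero]
      refine tendsto_const_nhds.congr fun n => ?_
      rw [not_and_or, not_lt, not_lt] at h
      rcases h with h | h <;> simp [tens, α, step_of_le h]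
  have hval := tendsto_nhds_unique (hlim.congr hid) hpl
  have hEp : 0 < E p := by simp only [hE]; positivity
  have : ∫ q, g q * E p * cornerKernel p q ∂quadrantMeasure
      = E p * cornerPotential g p := by
    rw [cornerPotential, ← integral_const_mul]
    refine integral_congr_ae (Eventually.of_forall fun q => ?_)
    ring
  rw [this, hv, Set.indicator_of_mem hp, mul_comm] at hval
  exact (mul_right_cancel₀ hEp.ne' hval).symm

/-! ### Test functions and weak derivatives -/

lemma IsTestFunction.fderiv_apply {φ : ℝ × ℝ → ℝ} (h : IsTestFunction φ) (e : ℝ × ℝ) :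
    IsTestFunction (fun p => fderiv ℝ φ p e) :=
  ⟨(h.smooth.fderiv_right (by simp)).clm_apply contDiff_const,
    h.compact.fderiv_apply (𝕜 := ℝ) e,
    (tsupport_fderiv_apply_subset ℝ e).trans h.support⟩

lemma IsTestFunction.classicalDeriv {φ : ℝ × ℝ → ℝ} (h : IsTestFunction φ) :
    ∀ l : List (ℝ × ℝ), IsTestFunction (classicalDeriv l φ)
  | [] => h
  | e :: l => (h.classicalDeriv l).fderiv_apply e

lemma IsTestFunction.memLp {φ : ℝ × ℝ → ℝ} (h : IsTestFunction φ) :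
    MemLp φ 2 quadrantMeasure :=
  (h.smooth.continuous.memLp_of_hasCompactSupport h.compact).restrict _

lemma HasL2WeakDeriv.congr {l : List (ℝ × ℝ)} {u u' w w' : ℝ × ℝ → ℝ}
    (h : HasL2WeakDeriv l u w) (hu : u =ᵐ[quadrantMeasure] u')
    (hw : w =ᵐ[quadrantMeasure] w') : HasL2WeakDeriv l u' w' := by
  refine ⟨h.1.ae_eq hw, fun φ hφ => ?_⟩
  have e1 : ∫ p, u' p * classicalDeriv l φ p ∂quadrantMeasure
      = ∫ p, u p * classicalDeriv l φ p ∂quadrantMeasure := by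
    refine integral_congr_ae ?_
    filter_upwards [hu] with p hp
    rw [hp]
  have e2 : ∫ p, w' p * φ p ∂quadrantMeasure = ∫ p, w p * φ p ∂quadrantMeasure := by
    refine integral_congr_ae ?_
    filter_upwards [hw] with p hp
    rw [hp]
  rw [e1, e2, h.2 φ hφ]

lemma HasL2WeakDeriv.ae_unique {l : List (ℝ × ℝ)} {u w w' : ℝ × ℝ → ℝ}
    (h : HasL2WeakDeriv l u w) (h' : HasL2WeakDeriv l u w') : w =ᵐ[quadrantMeasure] w' := by
  have hloc : LocallyIntegrable (fun p => w p - w' p) quadrantMeasure :=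
    haveI : IsLocallyFiniteMeasure quadrantMeasure := by
      unfold quadrantMeasure; infer_instance
    (h.1.sub h'.1).locallyIntegrable (by norm_num)
  have := isOpen_openQuadrant.ae_eq_zero_of_integral_contDiff_smul_eq_zero
    (hloc.locallyIntegrableOn openQuadrant) (fun φ h1 h2 h3 => by
      have hφ : IsTestFunction φ := ⟨h1, h2, h3⟩
      have e := (h.2 φ hφ).symm.trans (h'.2 φ hφ)
      have e' := mul_left_cancel₀ (pow_ne_zero _ (by norm_num)) e
      simp only [smul_eq_mul, mul_sub]
      simp only [mul_comm (φ _)]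
      rw [integral_sub (integrable_mul_of_memLp h.1 hφ.memLp)
        (integrable_mul_of_memLp h'.1 hφ.memLp), e', sub_self])
  filter_upwards [this, ae_mem_openQuadrant] with p hp hpQ
  exact sub_eq_zero.1 (hp hpQ)

lemma ae_eq_weakDeriv {l : List (ℝ × ℝ)} {u w : ℝ × ℝ → ℝ} (h : HasL2WeakDeriv l u w) :
    weakDeriv l u =ᵐ[quadrantMeasure] w := by
  have hex : ∃ w, HasL2WeakDeriv l u w := ⟨w, h⟩
  rw [weakDeriv, dif_pos hex]
  exact hex.choose_spec.ae_unique h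

/-- Integration by parts of a smooth function against a test function on the quadrant. -/
lemma integral_mul_fderiv_testFunction {v φ : ℝ × ℝ → ℝ} (hv : ContDiff ℝ ∞ v)
    (hφ : IsTestFunction φ) (e : ℝ × ℝ) :
    ∫ p, v p * fderiv ℝ φ p e ∂quadrantMeasure
      = -∫ p, fderiv ℝ v p e * φ p ∂quadrantMeasure := by
  have hφ' := hφ.fderiv_apply e
  have hext : ∀ f g : ℝ × ℝ → ℝ, IsTestFunction g →
      ∫ p, f p * g p ∂quadrantMeasure = ∫ p, f p * g p := by
    intro f g hg
    refine setIntegral_eq_integral_of_forall_compl_eq_zero fun p hp => ?_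
    rw [image_eq_zero_of_notMem_tsupport (fun h => hp (hg.support h)), mul_zero]
  have hv' : Continuous fun p => fderiv ℝ v p e :=
    (hv.continuous_fderiv (by simp)).clm_apply continuous_const
  rw [hext _ _ hφ, hext _ _ hφ']
  exact integral_mul_fderiv_eq_neg_fderiv_mul_of_integrable
    ((hv'.mul hφ.smooth.continuous).integrable_of_hasCompactSupport hφ.compact.mul_left)
    ((hv.continuous.mul hφ'.smooth.continuous).integrable_of_hasCompactSupport
      hφ'.compact.mul_left)
    ((hv.continuous.mul hφ.smooth.continuous).integrable_of_hasCompactSupport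
      hφ.compact.mul_left)
    (fun p _ => (hv.differentiable (by simp)) p)
    (fun p _ => (hφ.smooth.differentiable (by simp)) p)

section Tensor

variable {κ μ : ℝ} {ρ σ : ℝ → ℝ}

lemma hasL2WeakDeriv_tens_dirX (hκ : 0 < κ) (hμ : 0 < μ) (hρ : ContDiff ℝ ∞ ρ)
    (hσ : ContDiff ℝ ∞ σ) (hρd' : ExpDecay κ (deriv ρ)) (hσd : ExpDecay μ σ) :
    HasL2WeakDeriv dirX (tens ρ σ) (tens (deriv ρ) σ) := by
  refine ⟨memLp_tens hκ hμ (contDiff_deriv hρ).continuous hσ.continuous hρd' hσd,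
    fun φ hφ => ?_⟩
  have := integral_mul_fderiv_testFunction (contDiff_tens hρ hσ) hφ (1, 0)
  rw [← classicalDeriv_dirX_tens (differentiable_of_contDiff hρ) (differentiable_of_contDiff hσ)]
  simpa [dirX, classicalDeriv] using this

lemma hasL2WeakDeriv_tens_dirY (hκ : 0 < κ) (hμ : 0 < μ) (hρ : ContDiff ℝ ∞ ρ)
    (hσ : ContDiff ℝ ∞ σ) (hρd : ExpDecay κ ρ) (hσd' : ExpDecay μ (deriv σ)) :
    HasL2WeakDeriv dirY (tens ρ σ) (tens ρ (deriv σ)) := by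
  refine ⟨memLp_tens hκ hμ hρ.continuous (contDiff_deriv hσ).continuous hρd hσd',
    fun φ hφ => ?_⟩
  have := integral_mul_fderiv_testFunction (contDiff_tens hρ hσ) hφ (0, 1)
  rw [← classicalDeriv_dirY_tens (differentiable_of_contDiff hρ) (differentiable_of_contDiff hσ)]
  simpa [dirY, classicalDeriv] using this

lemma hasL2WeakDeriv_tens_dirXY (hκ : 0 < κ) (hμ : 0 < μ) (hρ : ContDiff ℝ ∞ ρ)
    (hσ : ContDiff ℝ ∞ σ) (hρd' : ExpDecay κ (deriv ρ)) (hσd' : ExpDecay μ (deriv σ)) :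
    HasL2WeakDeriv dirXY (tens ρ σ) (tens (deriv ρ) (deriv σ)) := by
  refine ⟨memLp_tens hκ hμ (contDiff_deriv hρ).continuous (contDiff_deriv hσ).continuous
    hρd' hσd', fun φ hφ => ?_⟩
  have h1 := integral_mul_fderiv_testFunction (contDiff_tens hρ hσ)
    (hφ.fderiv_apply (0, 1)) (1, 0)
  have h2 := integral_mul_fderiv_testFunction (contDiff_tens (contDiff_deriv hρ) hσ) hφ (0, 1)
  have e1 : ∀ p, fderiv ℝ (tens ρ σ) p (1, 0) = tens (deriv ρ) σ p := fun p =>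
    congrFun (classicalDeriv_dirX_tens (differentiable_of_contDiff hρ)
      (differentiable_of_contDiff hσ)) p
  have e2 : ∀ p, fderiv ℝ (tens (deriv ρ) σ) p (0, 1) = tens (deriv ρ) (deriv σ) p := fun p =>
    congrFun (classicalDeriv_dirY_tens (differentiable_of_contDiff (contDiff_deriv hρ))
      (differentiable_of_contDiff hσ)) p
  simp only [e1] at h1
  simp only [e2] at h2
  simp only [dirXY, classicalDeriv]
  rw [h1, h2]
  simp

end Tensor

/-! ### The mixed Sobolev space as a closed subspace of a Hilbert space -/

/-- `L²` of the open quadrant. -/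
abbrev L2Q : Type := Lp ℝ 2 quadrantMeasure

/-- The Hilbert space of quadruples of `L²` functions, in which `u` is represented by
`(u, u_x, u_y, u_xy)`. -/
abbrev Jet : Type := PiLp 2 (fun _ : Fin 4 => L2Q)

/-- The functional `f ↦ ∫ f v` on `L²` of the quadrant. -/
def pairing {v : ℝ × ℝ → ℝ} (hv : MemLp v 2 quadrantMeasure) : L2Q →L[ℝ] ℝ :=
  innerSL ℝ (hv.toLp v)

lemma pairing_apply {v : ℝ × ℝ → ℝ} (hv : MemLp v 2 quadrantMeasure) (f : L2Q) :
    pairing hv f = ∫ p, f p * v p ∂quadrantMeasure := by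
  rw [pairing, innerSL_apply_apply, L2.inner_def]
  refine integral_congr_ae ?_
  filter_upwards [hv.coeFn_toLp] with p hp
  simp [hp]

/-- The coordinate projections of the space of jets. -/
def coord (i : Fin 4) : Jet →L[ℝ] L2Q := PiLp.proj 2 (fun _ : Fin 4 => L2Q) i

@[simp] lemma coord_apply (i : Fin 4) (z : Jet) : coord i z = z i := rfl

/-- The jets `z` for which `z i` is the weak derivative of `z 0` along the directions `l`. -/
def weakGraph (l : List (ℝ × ℝ)) (i : Fin 4) : Submodule ℝ Jet :=
  ⨅ φ : {φ : ℝ × ℝ → ℝ // IsTestFunction φ}, LinearMap.ker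
    ((pairing (φ.2.classicalDeriv l).memLp ∘L coord 0
      - (-1 : ℝ) ^ l.length • (pairing φ.2.memLp ∘L coord i) : Jet →L[ℝ] ℝ) : Jet →ₗ[ℝ] ℝ)

lemma mem_weakGraph {l : List (ℝ × ℝ)} {i : Fin 4} {z : Jet} :
    z ∈ weakGraph l i ↔ HasL2WeakDeriv l (z 0) (z i) := by
  simp only [weakGraph, Submodule.mem_iInf, LinearMap.mem_ker]
  constructor
  · intro h
    refine ⟨Lp.memLp _, fun φ hφ => ?_⟩
    have := h ⟨φ, hφ⟩
    simpa [pairing_apply, sub_eq_zero] using this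
  · intro h φ
    have := h.2 φ.1 φ.2
    simpa [pairing_apply, sub_eq_zero] using this

lemma isClosed_weakGraph (l : List (ℝ × ℝ)) (i : Fin 4) :
    IsClosed (weakGraph l i : Set Jet) := by
  simp only [weakGraph, Submodule.coe_iInf]
  exact isClosed_iInter fun φ => ContinuousLinearMap.isClosed_ker _

/-- The mixed Sobolev space, as the closed subspace of the jets `(u, u_x, u_y, u_xy)`. -/
def jetSpace : Submodule ℝ Jet := weakGraph dirX 1 ⊓ weakGraph dirY 2 ⊓ weakGraph dirXY 3

lemma mem_jetSpace {z : Jet} : z ∈ jetSpace ↔ HasL2WeakDeriv dirX (z 0) (z 1) ∧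
    HasL2WeakDeriv dirY (z 0) (z 2) ∧ HasL2WeakDeriv dirXY (z 0) (z 3) := by
  simp only [jetSpace, Submodule.mem_inf, mem_weakGraph, and_assoc]

instance : CompleteSpace jetSpace := by
  have : IsClosed (jetSpace : Set Jet) :=
    ((isClosed_weakGraph _ _).inter (isClosed_weakGraph _ _)).inter (isClosed_weakGraph _ _)
  exact this.completeSpace_coe

/-- The value at `p` of the continuous representative. -/
def evalAt (p : ℝ × ℝ) : jetSpace →L[ℝ] ℝ :=
  pairing (memLp_cornerKernel p) ∘L (coord 0 - coord 1 - coord 2 + coord 3)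
    ∘L jetSpace.subtypeL

/-- The function `u - u_x - u_y + u_xy`. -/
def jetSource (z : Jet) : ℝ × ℝ → ℝ := fun q => z 0 q - z 1 q - z 2 q + z 3 q

lemma memLp_jetSource (z : Jet) : MemLp (jetSource z) 2 quadrantMeasure := by
  have h : ∀ i, MemLp (fun q => z i q) 2 quadrantMeasure := fun i => Lp.memLp _
  exact (((h 0).sub (h 1)).sub (h 2)).add (h 3)

lemma evalAt_eq (p : ℝ × ℝ) (z : jetSpace) :
    evalAt p z = cornerPotential (jetSource z) p := by
  simp only [evalAt, ContinuousLinearMap.comp_apply, pairing_apply, cornerPotential, jetSource]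
  refine integral_congr_ae ?_
  set w : Jet := (z : Jet)
  filter_upwards [Lp.coeFn_add (w 0 - w 1 - w 2) (w 3), Lp.coeFn_sub (w 0 - w 1) (w 2),
    Lp.coeFn_sub (w 0) (w 1)] with q h1 h2 h3
  change (w 0 - w 1 - w 2 + w 3 : L2Q) q * _ = _
  rw [h1, Pi.add_apply, h2, Pi.sub_apply, h3, Pi.sub_apply]

lemma continuous_evalAt (z : jetSpace) : Continuous fun p => evalAt p z := by
  simp_rw [evalAt_eq]
  exact continuous_cornerPotential (memLp_jetSource _)

lemma evalAt_ae_eq (z : jetSpace) :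
    (fun p => evalAt p z) =ᵐ[quadrantMeasure] ((z : Jet) 0) := by
  obtain ⟨h1, h2, h3⟩ := mem_jetSpace.1 z.2
  simp_rw [evalAt_eq]
  exact (ae_eq_cornerPotential (Lp.memLp _) h1 h2 h3).symm

lemma evalAt_eq_of_isContinuousRep {z : jetSpace} {U : ℝ × ℝ → ℝ}
    (hU : IsContinuousRep ((z : Jet) 0) U) {p : ℝ × ℝ} (hp : p ∈ closedQuadrant) :
    evalAt p z = U p :=
  eqOn_closedQuadrant (continuous_evalAt z).continuousOn hU.1
    ((evalAt_ae_eq z).trans hU.2) hp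

/-- The jet of a function with given weak derivatives. -/
lemma exists_jet {u wx wy wxy : ℝ × ℝ → ℝ} (hu : MemLp u 2 quadrantMeasure)
    (hx : HasL2WeakDeriv dirX u wx) (hy : HasL2WeakDeriv dirY u wy)
    (hxy : HasL2WeakDeriv dirXY u wxy) :
    ∃ z : jetSpace, u =ᵐ[quadrantMeasure] (z : Jet) 0 ∧ wx =ᵐ[quadrantMeasure] (z : Jet) 1 ∧
      wy =ᵐ[quadrantMeasure] (z : Jet) 2 ∧ wxy =ᵐ[quadrantMeasure] (z : Jet) 3 := by
  have e0 := hu.coeFn_toLp.symm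
  have e1 := hx.1.coeFn_toLp.symm
  have e2 := hy.1.coeFn_toLp.symm
  have e3 := hxy.1.coeFn_toLp.symm
  exact ⟨⟨WithLp.toLp 2 ![hu.toLp u, hx.1.toLp wx, hy.1.toLp wy, hxy.1.toLp wxy],
    mem_jetSpace.2 ⟨hx.congr e0 e1, hy.congr e0 e2, hxy.congr e0 e3⟩⟩, e0, e1, e2, e3⟩

/-! ### The energy as a quadratic form -/

/-- The bilinear form `(z, w) ↦ ⟨z i, w j⟩` on the mixed Sobolev space. -/
def coordForm (i j : Fin 4) : jetSpace →L[ℝ] jetSpace →L[ℝ] ℝ :=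
  (isBoundedBilinearMap_inner (𝕜 := ℝ) (E := L2Q)).toContinuousLinearMap.bilinearComp
    (coord i ∘L jetSpace.subtypeL) (coord j ∘L jetSpace.subtypeL)

lemma coordForm_apply (i j : Fin 4) (z w : jetSpace) :
    coordForm i j z w = inner ℝ ((z : Jet) i) ((w : Jet) j) := rfl

lemma coordForm_eq_integral (i j : Fin 4) (z w : jetSpace) :
    coordForm i j z w = ∫ p, (z : Jet) i p * (w : Jet) j p ∂quadrantMeasure := by
  rw [coordForm_apply, L2.inner_def]
  simp [mul_comm]

/-- The polar form of the energy without its mixed term. -/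
def diagForm (a c d : ℝ) : jetSpace →L[ℝ] jetSpace →L[ℝ] ℝ :=
  coordForm 3 3 + a • coordForm 1 1 + c • coordForm 2 2 + d • coordForm 0 0

/-- The polar form of the mixed term `2 ∫ u_x u_y`. -/
def crossForm : jetSpace →L[ℝ] jetSpace →L[ℝ] ℝ := coordForm 1 2 + coordForm 2 1

lemma diagForm_apply (a c d : ℝ) (z w : jetSpace) : diagForm a c d z w =
    coordForm 3 3 z w + a * coordForm 1 1 z w + c * coordForm 2 2 z w
      + d * coordForm 0 0 z w := rfl

lemma crossForm_apply (z w : jetSpace) :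
    crossForm z w = coordForm 1 2 z w + coordForm 2 1 z w := rfl

lemma coordForm_comm (i j : Fin 4) (z w : jetSpace) :
    coordForm i j z w = coordForm j i w z := by
  rw [coordForm_apply, coordForm_apply, real_inner_comm]

lemma diagForm_comm (a c d : ℝ) (z w : jetSpace) :
    diagForm a c d z w = diagForm a c d w z := by
  simp only [diagForm_apply]
  rw [coordForm_comm 3, coordForm_comm 1, coordForm_comm 2, coordForm_comm 0]

lemma crossForm_comm (z w : jetSpace) : crossForm z w = crossForm w z := by
  simp only [crossForm_apply]
  rw [coordForm_comm 1 2 z w, coordForm_comm 2 1 z w]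
  ring

lemma diagForm_coercive {a c d : ℝ} (ha : 0 < a) (hc : 0 < c) (hd : 0 < d) :
    ∃ κ, 0 < κ ∧ ∀ z : jetSpace, κ * ‖z‖ ^ 2 ≤ diagForm a c d z z := by
  have hn : ∀ z : jetSpace, ‖z‖ ^ 2 = coordForm 0 0 z z + coordForm 1 1 z z
      + coordForm 2 2 z z + coordForm 3 3 z z := by
    intro z
    rw [← Submodule.norm_coe, PiLp.norm_sq_eq_of_L2, Fin.sum_univ_four]
    simp only [coordForm_apply, real_inner_self_eq_norm_sq]
  have hp : ∀ i (z : jetSpace), 0 ≤ coordForm i i z z := fun i z => by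
    rw [coordForm_apply]; exact real_inner_self_nonneg
  refine ⟨min (min 1 a) (min c d), by positivity, fun z => ?_⟩
  have h0 : min (min 1 a) (min c d) ≤ d := (min_le_right _ _).trans (min_le_right _ _)
  have h1 : min (min 1 a) (min c d) ≤ a := (min_le_left _ _).trans (min_le_right _ _)
  have h2 : min (min 1 a) (min c d) ≤ c := (min_le_right _ _).trans (min_le_left _ _)
  have h3 : min (min 1 a) (min c d) ≤ 1 := (min_le_left _ _).trans (min_le_left _ _)
  rw [hn, diagForm_apply]
  have k0 := mul_le_mul_of_nonneg_right h0 (hp 0 z)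
  have k1 := mul_le_mul_of_nonneg_right h1 (hp 1 z)
  have k2 := mul_le_mul_of_nonneg_right h2 (hp 2 z)
  have k3 := mul_le_mul_of_nonneg_right h3 (hp 3 z)
  linarith

lemma energy_eq (a b c d : ℝ) {u : ℝ × ℝ → ℝ} {z : jetSpace}
    (hu : u =ᵐ[quadrantMeasure] (z : Jet) 0) :
    energy a b c d u = diagForm a c d z z + b * crossForm z z := by
  obtain ⟨h1, h2, h3⟩ := mem_jetSpace.1 z.2
  have e1 := ae_eq_weakDeriv (h1.congr hu.symm EventuallyEq.rfl)
  have e2 := ae_eq_weakDeriv (h2.congr hu.symm EventuallyEq.rfl)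
  have e3 := ae_eq_weakDeriv (h3.congr hu.symm EventuallyEq.rfl)
  have hi : ∀ i j, Integrable (fun p => (z : Jet) i p * (z : Jet) j p) quadrantMeasure :=
    fun i j => integrable_mul_of_memLp (Lp.memLp _) (Lp.memLp _)
  have s1 := integral_linComb (hi 3 3) (hi 1 1) (hi 2 2) (hi 0 0) 1 a c d
  have i1 : Integrable (fun p => 1 * ((z : Jet) 3 p * (z : Jet) 3 p)
      + a * ((z : Jet) 1 p * (z : Jet) 1 p) + c * ((z : Jet) 2 p * (z : Jet) 2 p)
      + d * ((z : Jet) 0 p * (z : Jet) 0 p)) quadrantMeasure :=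
    ((((hi 3 3).const_mul 1).add ((hi 1 1).const_mul a)).add ((hi 2 2).const_mul c)).add
      ((hi 0 0).const_mul d)
  have s2 := integral_add i1 ((hi 1 2).const_mul (2 * b))
  rw [s1, integral_const_mul] at s2
  have hc : crossForm z z = 2 * coordForm 1 2 z z := by
    rw [crossForm_apply, coordForm_comm 2 1]; ring
  rw [hc, diagForm_apply]
  simp only [coordForm_eq_integral]
  refine Eq.trans (integral_congr_ae ?_) (s2.trans (by ring))
  filter_upwards [e1, e2, e3, hu] with p h1 h2 h3 h0
  rw [h1, h2, h3, h0]
  ring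

/-! ### Abstract quadratic minimization -/

section Abstract

variable {V : Type*} [NormedAddCommGroup V] [InnerProductSpace ℝ V] [CompleteSpace V]

lemma exists_representer {B : V →L[ℝ] V →L[ℝ] ℝ} {κ : ℝ} (hκ : 0 < κ)
    (hB : ∀ z, κ * ‖z‖ ^ 2 ≤ B z z) (ℓ : V →L[ℝ] ℝ) : ∃ r, ∀ z, B r z = ℓ z := by
  have hc : IsCoercive B := ⟨κ, hκ, fun u => by have := hB u; nlinarith⟩
  refine ⟨hc.continuousLinearEquivOfBilin.symm ((InnerProductSpace.toDual ℝ V).symm ℓ),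
    fun z => ?_⟩
  rw [← hc.continuousLinearEquivOfBilin_apply, ContinuousLinearEquiv.apply_symm_apply,
    InnerProductSpace.toDual_symm_apply]

/-- A coercive form stays coercive under small multiples of a bounded form, and negativity of a
functional at the representer of `ℓ` is an open condition. -/
lemma exists_pos_forall_representer_neg {B P : V →L[ℝ] V →L[ℝ] ℝ} {κ : ℝ} (hκ : 0 < κ)
    (hB : ∀ z, κ * ‖z‖ ^ 2 ≤ B z z) {ℓ ev : V →L[ℝ] ℝ} {r₀ : V} (h₀ : ∀ z, B r₀ z = ℓ z)
    (hneg : ev r₀ < 0) :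
    ∃ b₀ : ℝ, 0 < b₀ ∧ ∀ b : ℝ, |b| < b₀ →
      (∀ z, κ / 2 * ‖z‖ ^ 2 ≤ B z z + b * P z z) ∧
      ∃ r, (∀ z, B r z + b * P r z = ℓ z) ∧ ev r < 0 := by
  set N := ‖ev‖ * ‖P‖ * ‖r₀‖ * 2 / κ with hN
  have hN0 : 0 ≤ N := by positivity
  refine ⟨min (κ / (2 * (‖P‖ + 1))) (-ev r₀ / (N + 1)),
    lt_min (by positivity) (div_pos (by linarith) (by linarith)), fun b hb => ?_⟩
  have hb1 : |b| * (2 * (‖P‖ + 1)) < κ :=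
    (lt_div_iff₀ (by positivity)).1 (hb.trans_le (min_le_left _ _))
  have hb2 : |b| * (N + 1) < -ev r₀ :=
    (lt_div_iff₀ (by positivity)).1 (hb.trans_le (min_le_right _ _))
  have hP : ∀ x y, |b * P x y| ≤ |b| * (‖P‖ * ‖x‖ * ‖y‖) := fun x y => by
    rw [abs_mul]
    exact mul_le_mul_of_nonneg_left (P.le_opNorm₂ x y) (abs_nonneg b)
  have hco : ∀ z, κ / 2 * ‖z‖ ^ 2 ≤ B z z + b * P z z := by
    intro z
    have h1 := (abs_le.1 (hP z z)).1
    have h2 : |b| * ‖P‖ ≤ κ / 2 := by nlinarith [abs_nonneg b]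
    have h3 := mul_le_mul_of_nonneg_right h2 (sq_nonneg ‖z‖)
    have h4 := hB z
    nlinarith
  obtain ⟨r, hr⟩ := exists_representer (B := B + b • P) (by positivity : 0 < κ / 2) hco ℓ
  have hr' : ∀ z, B r z + b * P r z = ℓ z := hr
  refine ⟨hco, r, hr', ?_⟩
  have h1 := hco (r - r₀)
  have h2 : B (r - r₀) (r - r₀) + b * P (r - r₀) (r - r₀) = -(b * P r₀ (r - r₀)) := by
    have e1 := hr' (r - r₀)
    have e2 := h₀ (r - r₀)
    have e3 : B (r - r₀) (r - r₀) = B r (r - r₀) - B r₀ (r - r₀) := by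
      rw [map_sub B r r₀]; rfl
    have e4 : P (r - r₀) (r - r₀) = P r (r - r₀) - P r₀ (r - r₀) := by
      rw [map_sub P r r₀]; rfl
    rw [e3, e4]
    linarith
  have h3 := (abs_le.1 (hP r₀ (r - r₀))).1
  have h4 : ‖r - r₀‖ ≤ |b| * (‖P‖ * ‖r₀‖ * 2 / κ) := by
    rcases (norm_nonneg (r - r₀)).eq_or_lt with h | h
    · rw [← h]; positivity
    · have h5 : (κ / 2 * ‖r - r₀‖) * ‖r - r₀‖ ≤ (|b| * (‖P‖ * ‖r₀‖)) * ‖r - r₀‖ := by nlinarith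
      have h6 := le_of_mul_le_mul_right h5 h
      have h7 : |b| * (‖P‖ * ‖r₀‖ * 2 / κ) = (|b| * (‖P‖ * ‖r₀‖)) * 2 / κ := by ring
      rw [h7, le_div_iff₀ hκ]
      linarith
  have h5 : ev (r - r₀) ≤ |b| * N := by
    calc ev (r - r₀) ≤ ‖ev (r - r₀)‖ := le_abs_self _
      _ ≤ ‖ev‖ * ‖r - r₀‖ := ev.le_opNorm _
      _ ≤ ‖ev‖ * (|b| * (‖P‖ * ‖r₀‖ * 2 / κ)) := mul_le_mul_of_nonneg_left h4 (norm_nonneg _)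
      _ = |b| * N := by rw [hN]; ring
  rw [map_sub] at h5
  nlinarith [abs_nonneg b]

end Abstract

/-! ### Test profiles with vanishing derivative at the origin -/

/-- The Gaussian `e^{-x²/s²}`. -/
def gauss (s x : ℝ) : ℝ := Real.exp (-(x ^ 2 / s ^ 2))

/-- The solution `ρ` of `λ² ρ - ρ'' = -e^{λ x} gauss'`, `ρ'(0) = 0`, which decays at infinity.
Writing the right-hand side through the derivative of a decreasing function makes `ρ` explicit and
visibly increasing in `s`. -/
def profile (lam s x : ℝ) : ℝ :=
  Real.exp (-(lam * x)) * (1 / lam + ∫ r in (0 : ℝ)..x, Real.exp (2 * lam * r) * gauss s r)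

/-- The nonnegative function `λ² ρ - ρ''` of the profile `ρ`. -/
def profileSource (lam s x : ℝ) : ℝ :=
  Real.exp (lam * x) * (2 * x / s ^ 2 * gauss s x)

lemma contDiff_gauss (s : ℝ) : ContDiff ℝ ∞ (gauss s) := by
  unfold gauss; fun_prop

lemma gauss_pos (s x : ℝ) : 0 < gauss s x := Real.exp_pos _

lemma hasDerivAt_gauss (s x : ℝ) : HasDerivAt (gauss s) (-(2 * x / s ^ 2 * gauss s x)) x := by
  have h : HasDerivAt (fun x : ℝ => -(x ^ 2 / s ^ 2)) (-(2 * x / s ^ 2)) x := by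
    simpa using ((hasDerivAt_pow 2 x).div_const (s ^ 2)).fun_neg
  have := h.exp
  unfold gauss
  convert this using 1
  ring

lemma gauss_le_gauss {s t x : ℝ} (hs : 0 < s) (hst : s ≤ t) : gauss s x ≤ gauss t x := by
  unfold gauss
  refine Real.exp_le_exp.2 (neg_le_neg ?_)
  gcongr

lemma gauss_antitone {s x y : ℝ} (hx : 0 ≤ x) (hxy : x ≤ y) : gauss s y ≤ gauss s x := by
  unfold gauss
  refine Real.exp_le_exp.2 (neg_le_neg ?_)
  gcongr

/-- Gaussians decay faster than any exponential. -/
lemma exp_mul_gauss_le {s : ℝ} (hs : 0 < s) (m x : ℝ) :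
    Real.exp (m * x) * gauss s x ≤ Real.exp (m ^ 2 * s ^ 2 / 4) := by
  unfold gauss
  rw [← Real.exp_add, Real.exp_le_exp]
  have h : x = (x / s) * s := by field_simp
  have h2 : x ^ 2 / s ^ 2 = (x / s) ^ 2 := by rw [div_pow]
  rw [h2]
  nth_rewrite 1 [h]
  nlinarith [sq_nonneg (m * s / 2 - x / s)]

section Profile

variable {lam s : ℝ}

lemma hasDerivAt_profile (x : ℝ) : HasDerivAt (profile lam s)
    (-lam * profile lam s x + Real.exp (lam * x) * gauss s x) x := by
  have hc : Continuous fun r => Real.exp (2 * lam * r) * gauss s r :=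
    (by fun_prop : Continuous fun r => Real.exp (2 * lam * r)).mul (contDiff_gauss s).continuous
  have h1 : HasDerivAt (fun x => ∫ r in (0 : ℝ)..x, Real.exp (2 * lam * r) * gauss s r)
      (Real.exp (2 * lam * x) * gauss s x) x :=
    hc.integral_hasStrictDerivAt 0 x |>.hasDerivAt
  have h2 : HasDerivAt (fun x : ℝ => Real.exp (-(lam * x)))
      (Real.exp (-(lam * x)) * -lam) x := by
    have : HasDerivAt (fun x : ℝ => -(lam * x)) (-lam) x := by
      simpa using ((hasDerivAt_id x).const_mul lam).fun_neg
    exact this.exp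
  have h3 := h2.mul (h1.const_add (1 / lam))
  have e : Real.exp (-(lam * x)) * (Real.exp (2 * lam * x) * gauss s x)
      = Real.exp (lam * x) * gauss s x := by
    rw [← mul_assoc, ← Real.exp_add]; congr 2; ring
  unfold profile
  refine h3.congr_deriv ?_
  rw [e]; ring

lemma deriv_profile : deriv (profile lam s) =
    fun x => -lam * profile lam s x + Real.exp (lam * x) * gauss s x :=
  funext fun x => (hasDerivAt_profile x).deriv

lemma deriv_deriv_profile (x : ℝ) : deriv (deriv (profile lam s)) x =
    lam ^ 2 * profile lam s x - profileSource lam s x := by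
  have h2 : HasDerivAt (fun x : ℝ => Real.exp (lam * x)) (Real.exp (lam * x) * lam) x := by
    have : HasDerivAt (fun x : ℝ => lam * x) lam x := by
      simpa using (hasDerivAt_id x).const_mul lam
    exact this.exp
  have := ((hasDerivAt_profile (lam := lam) (s := s) x).const_mul (-lam)).add
    (h2.mul (hasDerivAt_gauss s x))
  rw [deriv_profile]
  refine this.deriv.trans ?_
  simp only [profileSource]
  ring

lemma contDiff_profile : ContDiff ℝ ∞ (profile lam s) := by
  have hg : ContDiff ℝ ∞ fun x => Real.exp (2 * lam * x) * gauss s x :=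
    (by fun_prop : ContDiff ℝ ∞ fun x : ℝ => Real.exp (2 * lam * x)).mul (contDiff_gauss s)
  have hi : ContDiff ℝ ∞ fun x => ∫ r in (0 : ℝ)..x, Real.exp (2 * lam * r) * gauss s r := by
    have hd : ∀ x, HasDerivAt (fun x => ∫ r in (0 : ℝ)..x, Real.exp (2 * lam * r) * gauss s r)
      (Real.exp (2 * lam * x) * gauss s x) x := fun x =>
        hg.continuous.integral_hasStrictDerivAt 0 x |>.hasDerivAt
    rw [contDiff_infty_iff_deriv]
    refine ⟨fun x => (hd x).differentiableAt, ?_⟩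
    rw [funext fun x => (hd x).deriv]
    exact hg
  unfold profile
  exact (by fun_prop : ContDiff ℝ ∞ fun x : ℝ => Real.exp (-(lam * x))).mul
    (contDiff_const.add hi)

lemma profile_zero : profile lam s 0 = 1 / lam := by simp [profile]

lemma deriv_profile_zero (hl : 0 < lam) : deriv (profile lam s) 0 = 0 := by
  rw [deriv_profile]
  simp [profile_zero, gauss, hl.ne']

lemma expDecay_exp_mul_gauss (hs : 0 < s) :
    ExpDecay lam (fun x => Real.exp (lam * x) * gauss s x) := by
  refine ⟨Real.exp ((2 * lam) ^ 2 * s ^ 2 / 4), fun x _ => ?_⟩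
  rw [abs_of_pos (mul_pos (Real.exp_pos _) (gauss_pos _ _))]
  calc _ = Real.exp (2 * lam * x) * gauss s x * Real.exp (-(lam * x)) := by
        rw [mul_right_comm (Real.exp (2 * lam * x)), ← Real.exp_add]; congr 2; ring
    _ ≤ _ := mul_le_mul_of_nonneg_right (exp_mul_gauss_le hs _ _) (Real.exp_pos _).le

lemma expDecay_profile (hl : 0 < lam) (hs : 0 < s) : ExpDecay lam (profile lam s) := by
  set K := Real.exp ((2 * lam + 1) ^ 2 * s ^ 2 / 4) with hK
  have hbd : ∀ r, Real.exp (2 * lam * r) * gauss s r ≤ K * Real.exp (-r) := fun r => by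
    calc _ = Real.exp ((2 * lam + 1) * r) * gauss s r * Real.exp (-r) := by
          rw [mul_right_comm (Real.exp ((2 * lam + 1) * r)), ← Real.exp_add]; congr 2; ring
      _ ≤ _ := mul_le_mul_of_nonneg_right (exp_mul_gauss_le hs _ _) (Real.exp_pos _).le
  have hc : Continuous fun r => Real.exp (2 * lam * r) * gauss s r :=
    (by fun_prop : Continuous fun r => Real.exp (2 * lam * r)).mul (contDiff_gauss s).continuous
  refine ⟨1 / lam + K, fun x hx => ?_⟩
  have h0 : 0 ≤ ∫ r in (0 : ℝ)..x, Real.exp (2 * lam * r) * gauss s r :=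
    intervalIntegral.integral_nonneg hx.le fun r _ =>
      (mul_pos (Real.exp_pos _) (gauss_pos _ _)).le
  have h1 : ∫ r in (0 : ℝ)..x, Real.exp (2 * lam * r) * gauss s r ≤ K := by
    calc _ ≤ ∫ r in (0 : ℝ)..x, K * Real.exp (-r) :=
          intervalIntegral.integral_mono_on hx.le (hc.intervalIntegrable _ _)
            ((by fun_prop : Continuous fun r => K * Real.exp (-r)).intervalIntegrable _ _)
            fun r _ => hbd r
      _ = K * (1 - Real.exp (-x)) := by
          rw [intervalIntegral.integral_const_mul, intervalIntegral.integral_comp_neg,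
            integral_exp]
          simp
      _ ≤ K * 1 := by
          have := Real.exp_pos (-x)
          have := Real.exp_pos ((2 * lam + 1) ^ 2 * s ^ 2 / 4)
          gcongr; linarith
      _ = K := mul_one K
  rw [profile, abs_of_nonneg (by positivity), mul_comm]
  gcongr

lemma expDecay_deriv_profile (hl : 0 < lam) (hs : 0 < s) :
    ExpDecay lam (deriv (profile lam s)) := by
  rw [deriv_profile]
  exact ((expDecay_profile hl hs).const_mul _).add (expDecay_exp_mul_gauss hs)

/-- The source of the profile with parameter `s` is bounded by `4 λ / s` times the profile with the
larger parameter `2 s`. -/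
lemma profileSource_le (hl : 0 < lam) (hs : 0 < s) {x : ℝ} (hx : 0 ≤ x) :
    profileSource lam s x ≤ 4 * lam / s * profile lam (2 * s) x := by
  have hc : Continuous fun r => Real.exp (2 * lam * r) * gauss (2 * s) r :=
    (by fun_prop : Continuous fun r => Real.exp (2 * lam * r)).mul
      (contDiff_gauss _).continuous
  have hg1 : gauss (2 * s) x ≤ 1 := by
    unfold gauss
    exact Real.exp_le_one_iff.2 (neg_nonpos.2 (by positivity))
  -- the profile dominates `e^{λ x} gauss (2 s) x / (2 λ)` because the Gaussian is decreasing
  have h1 : gauss (2 * s) x * ((Real.exp (2 * lam * x) - 1) / (2 * lam))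
      ≤ ∫ r in (0 : ℝ)..x, Real.exp (2 * lam * r) * gauss (2 * s) r := by
    calc _ = ∫ r in (0 : ℝ)..x, Real.exp (2 * lam * r) * gauss (2 * s) x := by
          rw [intervalIntegral.integral_mul_const,
            intervalIntegral.integral_comp_mul_left (fun r => Real.exp r) (by positivity),
            integral_exp]
          simp; field_simp
      _ ≤ _ := intervalIntegral.integral_mono_on hx
          ((by fun_prop : Continuous fun r =>
            Real.exp (2 * lam * r) * gauss (2 * s) x).intervalIntegrable _ _)
          (hc.intervalIntegrable _ _) fun r hr =>
            mul_le_mul_of_nonneg_left (gauss_antitone hr.1 hr.2) (Real.exp_pos _).le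
  have h2 : Real.exp (lam * x) * gauss (2 * s) x / (2 * lam) ≤ profile lam (2 * s) x := by
    have e : Real.exp (lam * x) = Real.exp (-(lam * x)) * Real.exp (2 * lam * x) := by
      rw [← Real.exp_add]; congr 1; ring
    rw [profile, e, mul_assoc, mul_div_assoc]
    refine mul_le_mul_of_nonneg_left ?_ (Real.exp_pos _).le
    have h3 : gauss (2 * s) x / (2 * lam) ≤ 1 / lam := by
      rw [div_le_div_iff₀ (by positivity) hl]
      nlinarith
    have h4 : Real.exp (2 * lam * x) * gauss (2 * s) x / (2 * lam) =
        gauss (2 * s) x / (2 * lam)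
          + gauss (2 * s) x * ((Real.exp (2 * lam * x) - 1) / (2 * lam)) := by ring
    rw [h4]
    linarith
  -- with `y = x / s`, this is `y e^{-3 y² / 4} ≤ 1`
  have h3 : x / s * gauss s x ≤ gauss (2 * s) x := by
    have e : gauss s x = Real.exp (-(3 / 4 * (x / s) ^ 2)) * gauss (2 * s) x := by
      unfold gauss
      rw [← Real.exp_add]
      congr 1
      field_simp
      ring
    rw [e, ← mul_assoc]
    refine mul_le_of_le_one_left (gauss_pos _ _).le ?_
    rw [Real.exp_neg, ← div_eq_mul_inv, div_le_one (Real.exp_pos _)]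
    have := Real.add_one_le_exp (3 / 4 * (x / s) ^ 2)
    nlinarith [sq_nonneg (x / s - 2 / 3)]
  calc profileSource lam s x = 2 / s * Real.exp (lam * x) * (x / s * gauss s x) := by
        unfold profileSource; field_simp
    _ ≤ 2 / s * Real.exp (lam * x) * gauss (2 * s) x :=
        mul_le_mul_of_nonneg_left h3 (by positivity)
    _ = 4 * lam / s * (Real.exp (lam * x) * gauss (2 * s) x / (2 * lam)) := by
        field_simp; ring
    _ ≤ _ := mul_le_mul_of_nonneg_left h2 (by positivity)

lemma profileSource_nonneg {x : ℝ} (hx : 0 ≤ x) : 0 ≤ profileSource lam s x := by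
  have := gauss_pos s x
  unfold profileSource
  positivity

lemma profileSource_pos (hs : 0 < s) {x : ℝ} (hx : 0 < x) : 0 < profileSource lam s x := by
  have := gauss_pos s x
  unfold profileSource
  positivity

lemma profile_mono {t : ℝ} (hs : 0 < s) (hst : s ≤ t) {x : ℝ} (hx : 0 ≤ x) :
    profile lam s x ≤ profile lam t x := by
  have hc : ∀ s, Continuous fun r => Real.exp (2 * lam * r) * gauss s r := fun s =>
    (by fun_prop : Continuous fun r => Real.exp (2 * lam * r)).mul (contDiff_gauss s).continuous
  unfold profile
  refine mul_le_mul_of_nonneg_left (add_le_add le_rfl ?_) (Real.exp_pos _).le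
  exact intervalIntegral.integral_mono_on hx ((hc s).intervalIntegrable _ _)
    ((hc t).intervalIntegrable _ _) fun r _ =>
      mul_le_mul_of_nonneg_left (gauss_le_gauss hs hst) (Real.exp_pos _).le

lemma continuous_profileSource : Continuous (profileSource lam s) := by
  have := (contDiff_gauss s).continuous
  unfold profileSource
  fun_prop

lemma expDecay_profileSource (hl : 0 < lam) (hs : 0 < s) :
    ExpDecay lam (profileSource lam s) := by
  obtain ⟨C, hC⟩ := (expDecay_profile hl (by positivity : 0 < 2 * s)).const_mul (4 * lam / s)
  refine ⟨C, fun x hx => ?_⟩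
  rw [abs_of_nonneg (profileSource_nonneg hx.le)]
  exact ((profileSource_le hl hs hx.le).trans (le_abs_self _)).trans (hC x hx)

end Profile

/-! ### Change of sign without mixed term -/

section Sign

variable {a c d : ℝ}

lemma expDecay_deriv_deriv_profile {lam s : ℝ} (hl : 0 < lam) (hs : 0 < s) :
    ExpDecay lam (deriv (deriv (profile lam s))) := by
  rw [funext (deriv_deriv_profile (lam := lam) (s := s))]
  exact ((expDecay_profile hl hs).const_mul _).sub (expDecay_profileSource hl hs)

/-- The Euler-Lagrange equation tested with a tensor product of profiles. The form splits as
`(-∂_x² + c)(-∂_y² + a) + (d - a c)`, and there are no boundary terms since the derivatives of the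
profiles vanish at `0`. -/
lemma integral_profileSource_add_integral_profile (ha : 0 < a) (hc : 0 < c) {z : jetSpace}
    (hz : ∀ w, diagForm a c d z w = evalAt (0, 0) w) {s t : ℝ} (hs : 0 < s) (ht : 0 < t) :
    ∫ p, (z : Jet) 0 p * tens (profileSource √c s) (profileSource √a t) p ∂quadrantMeasure
      + (d - a * c) * ∫ p, (z : Jet) 0 p * tens (profile √c s) (profile √a t) p ∂quadrantMeasure
      = 1 / √c * (1 / √a) := by
  have hl : 0 < √c := Real.sqrt_pos.2 hc
  have hm : 0 < √a := Real.sqrt_pos.2 ha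
  have sρ := contDiff_profile (lam := √c) (s := s)
  have sσ := contDiff_profile (lam := √a) (s := t)
  have dρ := expDecay_profile hl hs
  have dσ := expDecay_profile hm ht
  have dρ' := expDecay_deriv_profile hl hs
  have dσ' := expDecay_deriv_profile hm ht
  have dρ'' := expDecay_deriv_deriv_profile hl hs
  have dσ'' := expDecay_deriv_deriv_profile hm ht
  have sρ' := contDiff_deriv sρ
  have sσ' := contDiff_deriv sσ
  have sρ'' := contDiff_deriv sρ'
  have sσ'' := contDiff_deriv sσ'
  have hu : MemLp ((z : Jet) 0) 2 quadrantMeasure := Lp.memLp _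
  obtain ⟨w, w0, w1, w2, w3⟩ := exists_jet
    (memLp_tens hl hm sρ.continuous sσ.continuous dρ dσ)
    (hasL2WeakDeriv_tens_dirX hl hm sρ sσ dρ' dσ)
    (hasL2WeakDeriv_tens_dirY hl hm sρ sσ dρ dσ')
    (hasL2WeakDeriv_tens_dirXY hl hm sρ sσ dρ' dσ')
  have hval : evalAt (0, 0) w = 1 / √c * (1 / √a) := by
    rw [evalAt_eq_of_isContinuousRep (U := tens (profile √c s) (profile √a t))
      ⟨(continuous_tens sρ.continuous sσ.continuous).continuousOn, w0.symm⟩ ⟨le_rfl, le_rfl⟩]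
    simp only [tens, profile_zero]
  have hform : ∀ (i : Fin 4) (f : ℝ × ℝ → ℝ), f =ᵐ[quadrantMeasure] (w : Jet) i →
      coordForm i i z w = ∫ p, (z : Jet) i p * f p ∂quadrantMeasure := by
    intro i f hf
    rw [coordForm_eq_integral]
    refine integral_congr_ae ?_
    filter_upwards [hf] with p hp
    rw [hp]
  obtain ⟨h1, h2, h3⟩ := mem_jetSpace.1 z.2
  have e1 := h1.integral_tens_dirX hu hl hm sρ' sσ dρ' dρ'' dσ (deriv_profile_zero hl)
  have e2 := h2.integral_tens_dirY hu hl hm sρ sσ' dρ dσ' dσ'' (deriv_profile_zero hm)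
  have e3 := h3.integral_tens_dirXY hu hl hm sρ' sσ' dρ' dρ'' dσ' dσ''
    (deriv_profile_zero hl) (deriv_profile_zero hm)
  have key := hz w
  rw [hval, diagForm_apply, hform 3 _ w3, hform 1 _ w1, hform 2 _ w2, hform 0 _ w0, e1, e2,
    e3] at key
  have i1 := integrable_mul_of_memLp hu
    (memLp_tens hl hm sρ''.continuous sσ''.continuous dρ'' dσ'')
  have i2 := integrable_mul_of_memLp hu
    (memLp_tens hl hm sρ''.continuous sσ.continuous dρ'' dσ)
  have i3 := integrable_mul_of_memLp hu
    (memLp_tens hl hm sρ.continuous sσ''.continuous dρ dσ'')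
  have i4 := integrable_mul_of_memLp hu
    (memLp_tens hl hm sρ.continuous sσ.continuous dρ dσ)
  have i5 := integrable_mul_of_memLp hu
    (memLp_tens hl hm continuous_profileSource continuous_profileSource
      (expDecay_profileSource hl hs) (expDecay_profileSource hm ht))
  have hsum := integral_linComb i1 i2 i3 i4 1 (-a) (-c) d
  have hsum' : ∫ p, ((z : Jet) 0 p * tens (profileSource √c s) (profileSource √a t) p
      + (d - a * c) * ((z : Jet) 0 p * tens (profile √c s) (profile √a t) p)) ∂quadrantMeasure
      = ∫ p, (z : Jet) 0 p * tens (profileSource √c s) (profileSource √a t) p ∂quadrantMeasure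
      + (d - a * c) * ∫ p, (z : Jet) 0 p * tens (profile √c s) (profile √a t) p
          ∂quadrantMeasure := by
    rw [integral_add i5 (i4.const_mul _), integral_const_mul]
  rw [← hsum', ← key]
  refine Eq.trans (integral_congr_ae (Eventually.of_forall fun p => ?_))
    (hsum.trans (by ring))
  simp only [tens, deriv_deriv_profile, Real.sq_sqrt ha.le, Real.sq_sqrt hc.le]
  ring

/-- For `d > a c` the representer of the corner evaluation takes a negative value. If `u ≥ 0`,
write `F s t` and `P s t` for the integrals of `u` against the sources and the profiles. Then
`F s t + k P s t = M` with `k, M > 0` bounds `P`, hence `F s t ≤ C / (s t)`. Since the profiles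
increase in their parameter, `F 1 1 - F 1 s - F s 1 + F s s ≤ 0`, and `s → ∞` gives
`F 1 1 ≤ 0`, that is `u = 0`. -/
theorem exists_evalAt_neg (ha : 0 < a) (hc : 0 < c) (hacd : a * c < d) {z : jetSpace}
    (hz : ∀ w, diagForm a c d z w = evalAt (0, 0) w) :
    ∃ p ∈ closedQuadrant, evalAt p z < 0 := by
  by_contra! hpos
  have hl : 0 < √c := Real.sqrt_pos.2 hc
  have hm : 0 < √a := Real.sqrt_pos.2 ha
  have hk : 0 < d - a * c := by linarith
  set u : ℝ × ℝ → ℝ := fun p => (z : Jet) 0 p with hu_def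
  have hu : MemLp u 2 quadrantMeasure := Lp.memLp _
  have hu0 : ∀ᵐ p ∂quadrantMeasure, 0 ≤ u p := by
    filter_upwards [evalAt_ae_eq z, ae_mem_openQuadrant] with p hp hpQ
    simp only [hu_def]
    rw [← hp]
    exact hpos p ⟨hpQ.1.le, hpQ.2.le⟩
  set M := 1 / √c * (1 / √a) with hM
  set F : ℝ → ℝ → ℝ := fun s t =>
    ∫ p, u p * tens (profileSource √c s) (profileSource √a t) p ∂quadrantMeasure with hF
  set P : ℝ → ℝ → ℝ := fun s t =>
    ∫ p, u p * tens (profile √c s) (profile √a t) p ∂quadrantMeasure with hP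
  have hFP : ∀ s t, 0 < s → 0 < t → F s t + (d - a * c) * P s t = M := fun s t hs ht =>
    integral_profileSource_add_integral_profile ha hc hz hs ht
  have iF : ∀ s t, 0 < s → 0 < t →
      Integrable (fun p => u p * tens (profileSource √c s) (profileSource √a t) p)
        quadrantMeasure := fun s t hs ht =>
    integrable_mul_of_memLp hu (memLp_tens hl hm continuous_profileSource
      continuous_profileSource (expDecay_profileSource hl hs) (expDecay_profileSource hm ht))
  have iP : ∀ s t, 0 < s → 0 < t →
      Integrable (fun p => u p * tens (profile √c s) (profile √a t) p) quadrantMeasure :=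
    fun s t hs ht => integrable_mul_of_memLp hu (memLp_tens hl hm contDiff_profile.continuous
      contDiff_profile.continuous (expDecay_profile hl hs) (expDecay_profile hm ht))
  have hF0 : ∀ s t, 0 ≤ F s t := fun s t => by
    refine integral_nonneg_of_ae ?_
    filter_upwards [hu0, ae_mem_openQuadrant] with p hp hpQ
    exact mul_nonneg hp (mul_nonneg (profileSource_nonneg hpQ.1.le)
      (profileSource_nonneg hpQ.2.le))
  have hFle : ∀ s t, 0 < s → 0 < t → F s t ≤ 16 * √c * √a * (M / (d - a * c)) / (s * t) := by
    intro s t hs ht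
    have h1 : F s t ≤ (4 * √c / s) * (4 * √a / t) * P (2 * s) (2 * t) := by
      simp only [hF, hP]
      rw [← integral_const_mul]
      refine integral_mono_ae (iF s t hs ht)
        ((iP (2 * s) (2 * t) (by positivity) (by positivity)).const_mul _) ?_
      filter_upwards [hu0, ae_mem_openQuadrant] with p hp hpQ
      have k1 := profileSource_le hl hs hpQ.1.le
      have k2 := profileSource_le hm ht hpQ.2.le
      calc u p * tens (profileSource √c s) (profileSource √a t) p
          ≤ u p * ((4 * √c / s * profile √c (2 * s) p.1)
            * (4 * √a / t * profile √a (2 * t) p.2)) :=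
            mul_le_mul_of_nonneg_left (mul_le_mul k1 k2 (profileSource_nonneg hpQ.2.le)
              ((profileSource_nonneg hpQ.1.le).trans k1)) hp
        _ = _ := by simp only [tens]; ring
    have h2 : P (2 * s) (2 * t) ≤ M / (d - a * c) := by
      rw [le_div_iff₀ hk]
      have := hFP (2 * s) (2 * t) (by positivity) (by positivity)
      have := hF0 (2 * s) (2 * t)
      linarith
    calc _ ≤ _ := h1
      _ ≤ (4 * √c / s) * (4 * √a / t) * (M / (d - a * c)) :=
          mul_le_mul_of_nonneg_left h2 (by positivity)
      _ = _ := by field_simp; ring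
  have hmixed : ∀ s, 1 ≤ s → F 1 1 ≤ F 1 s + F s 1 := by
    intro s hs
    have hs0 : 0 < s := by linarith
    have h1 : 0 ≤ P 1 1 - P 1 s - P s 1 + P s s := by
      have hsum := integral_linComb (iP 1 1 one_pos one_pos) (iP 1 s one_pos hs0)
        (iP s 1 hs0 one_pos) (iP s s hs0 hs0) 1 (-1) (-1) 1
      have h2 : 0 ≤ 1 * P 1 1 + -1 * P 1 s + -1 * P s 1 + 1 * P s s := by
        simp only [hP]
        rw [← hsum]
        refine integral_nonneg_of_ae ?_
        filter_upwards [hu0, ae_mem_openQuadrant] with p hp hpQ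
        have k1 := sub_nonneg.2 (profile_mono (lam := √c) one_pos hs hpQ.1.le)
        have k2 := sub_nonneg.2 (profile_mono (lam := √a) one_pos hs hpQ.2.le)
        refine (mul_nonneg hp (mul_nonneg k1 k2)).trans (le_of_eq ?_)
        simp only [tens]; ring
      linarith
    have e1 := hFP 1 1 one_pos one_pos
    have e2 := hFP 1 s one_pos hs0
    have e3 := hFP s 1 hs0 one_pos
    have e4 := hFP s s hs0 hs0
    have h3 := mul_nonneg hk.le h1
    have h4 := hF0 s s
    linarith
  have hF11 : F 1 1 = 0 := by
    refine le_antisymm ?_ (hF0 1 1)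
    set K := 16 * √c * √a * (M / (d - a * c)) with hK
    have hlim : Tendsto (fun n : ℕ => 2 * K * (1 / ((n : ℝ) + 1))) atTop (𝓝 0) := by
      simpa using tendsto_one_div_add_atTop_nhds_zero_nat.const_mul (2 * K)
    refine ge_of_tendsto' hlim fun n => ?_
    have hn : (0 : ℝ) < n + 1 := by positivity
    have h1 := hmixed (n + 1) (by linarith [n.cast_nonneg (α := ℝ)])
    have h2 := hFle 1 (n + 1) one_pos hn
    have h3 := hFle (n + 1) 1 hn one_pos
    rw [one_mul] at h2
    rw [mul_one] at h3
    have : 2 * K * (1 / ((n : ℝ) + 1)) = K / (n + 1) + K / (n + 1) := by ring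
    linarith
  have hzero : u =ᵐ[quadrantMeasure] fun _ => 0 := by
    have h1 := (integral_eq_zero_iff_of_nonneg_ae ?_ (iF 1 1 one_pos one_pos)).1 hF11
    · filter_upwards [h1, ae_mem_openQuadrant] with p hp hpQ
      have : tens (profileSource √c 1) (profileSource √a 1) p ≠ 0 :=
        (mul_pos (profileSource_pos one_pos hpQ.1) (profileSource_pos one_pos hpQ.2)).ne'
      exact (mul_eq_zero.1 hp).resolve_right this
    · filter_upwards [hu0, ae_mem_openQuadrant] with p hp hpQ
      exact mul_nonneg hp (mul_nonneg (profileSource_nonneg hpQ.1.le)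
        (profileSource_nonneg hpQ.2.le))
  have hP11 : P 1 1 = 0 := by
    refine integral_eq_zero_of_ae ?_
    filter_upwards [hzero] with p hp
    simp [hp]
  have h := hFP 1 1 one_pos one_pos
  rw [hF11, hP11] at h
  have hMpos : 0 < M := by positivity
  linarith

end Sign

/-! ### Admissible functions and minimizers -/

lemma Admissible.exists_jet {v : ℝ × ℝ → ℝ} (hv : Admissible v) :
    ∃ z : jetSpace, v =ᵐ[quadrantMeasure] (z : Jet) 0 ∧ evalAt (0, 0) z = 1 := by
  obtain ⟨⟨h0, ⟨_, h1⟩, ⟨_, h2⟩, ⟨_, h3⟩⟩, V, hV, hV1⟩ := hv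
  obtain ⟨z, hz, -⟩ := EkelandNirenberg.exists_jet h0 h1 h2 h3
  refine ⟨z, hz, ?_⟩
  rw [evalAt_eq_of_isContinuousRep (U := V) ⟨hV.1, hz.symm.trans hV.2⟩ ⟨le_rfl, le_rfl⟩, hV1]

lemma admissible_evalAt {z : jetSpace} (hz : evalAt (0, 0) z = 1) :
    Admissible (fun p => evalAt p z) := by
  obtain ⟨h1, h2, h3⟩ := mem_jetSpace.1 z.2
  have e := (evalAt_ae_eq z).symm
  exact ⟨⟨(Lp.memLp ((z : Jet) 0)).ae_eq e, ⟨_, h1.congr e EventuallyEq.rfl⟩,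
    ⟨_, h2.congr e EventuallyEq.rfl⟩, ⟨_, h3.congr e EventuallyEq.rfl⟩⟩,
    _, ⟨(continuous_evalAt z).continuousOn, EventuallyEq.rfl⟩, hz⟩

end EkelandNirenberg

end

theorem mainTheorem2 (a c d : ℝ) (ha : 0 < a) (hc : 0 < c) (hd : 0 < d) (hacd : a * c < d) :
    ∃ b₀ : ℝ, 0 < b₀ ∧ ∀ b : ℝ, |b| < b₀ →
      ∃ U : ℝ × ℝ → ℝ,
        ContinuousOn U EkelandNirenberg.closedQuadrant ∧
        EkelandNirenberg.IsConstrainedMinimizer a b c d U ∧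
        (∀ v : ℝ × ℝ → ℝ, EkelandNirenberg.IsConstrainedMinimizer a b c d v →
          v =ᵐ[EkelandNirenberg.quadrantMeasure] U) ∧
        EkelandNirenberg.ChangesSign U := by
  open EkelandNirenberg in
  obtain ⟨κ, hκ, hco⟩ := diagForm_coercive ha hc hd
  obtain ⟨r₀, hr₀⟩ := exists_representer hκ hco (evalAt (0, 0))
  obtain ⟨p, hp, hneg⟩ := exists_evalAt_neg ha hc hacd hr₀
  obtain ⟨b₀, hb₀, H⟩ := exists_pos_forall_representer_neg (P := crossForm) hκ hco hr₀ hneg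
  refine ⟨b₀, hb₀, fun b hb => ?_⟩
  obtain ⟨hcob, r, hr, hrneg⟩ := H b hb
  have hr_ne : r ≠ 0 := by
    rintro rfl
    simp at hrneg
  have hm : 0 < evalAt (0, 0) r := by
    rw [← hr r]
    have : 0 < ‖r‖ := norm_pos_iff.2 hr_ne
    exact lt_of_lt_of_le (by positivity) (hcob r)
  set m := evalAt (0, 0) r with hm_def
  set z := m⁻¹ • r with hz_def
  have hz1 : evalAt (0, 0) z = 1 := by
    rw [hz_def, map_smul, smul_eq_mul, ← hm_def, inv_mul_cancel₀ hm.ne']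
  have hzB : ∀ w, diagForm a c d z w + b * crossForm z w = m⁻¹ * evalAt (0, 0) w := fun w => by
    rw [hz_def, map_smul, map_smul, ← hr w]
    simp only [smul_apply, smul_eq_mul]
    ring
  -- completing the square: the first variation at `z` vanishes on the difference
  have hexp : ∀ w : jetSpace, evalAt (0, 0) w = 1 →
      diagForm a c d w w + b * crossForm w w = diagForm a c d z z + b * crossForm z z
        + (diagForm a c d (w - z) (w - z) + b * crossForm (w - z) (w - z)) := by
    intro w hw
    have h1 := hzB w
    have h2 := hzB z
    rw [hw] at h1
    rw [hz1] at h2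
    have e : ∀ B : jetSpace →L[ℝ] jetSpace →L[ℝ] ℝ, (∀ x y, B x y = B y x) →
        B (w - z) (w - z) = B w w - 2 * B z w + B z z := fun B hB => by
      simp only [map_sub, sub_apply]
      rw [hB w z]
      ring
    rw [e _ (diagForm_comm a c d), e _ crossForm_comm]
    linarith
  have hzU := evalAt_ae_eq z
  refine ⟨fun q => evalAt q z, (continuous_evalAt z).continuousOn,
    ⟨admissible_evalAt hz1, fun v hv => ?_⟩, fun v hv => ?_, ⟨(0, 0), ⟨le_rfl, le_rfl⟩, ?_⟩,
    p, hp, ?_⟩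
  · obtain ⟨w, hvw, hw⟩ := hv.exists_jet
    rw [energy_eq a b c d hvw, energy_eq a b c d hzU, hexp w hw]
    have := hcob (w - z)
    have : 0 ≤ κ / 2 * ‖w - z‖ ^ 2 := by positivity
    linarith
  · obtain ⟨w, hvw, hw⟩ := hv.1.exists_jet
    have hle := hv.2 _ (admissible_evalAt hz1)
    rw [energy_eq a b c d hvw, energy_eq a b c d hzU, hexp w hw] at hle
    have h1 := hcob (w - z)
    have h2 : ‖w - z‖ ^ 2 ≤ 0 := by
      by_contra! h
      have : 0 < κ / 2 * ‖w - z‖ ^ 2 := by positivity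
      linarith
    have h3 : w = z :=
      sub_eq_zero.1 (norm_eq_zero.1 (pow_eq_zero_iff two_ne_zero |>.1
        (le_antisymm h2 (sq_nonneg _))))
    rw [h3] at hvw
    exact hvw.trans hzU.symm
  · change 0 < evalAt (0, 0) z
    rw [hz1]; exact one_pos
  · change evalAt p z < 0
    rw [hz_def, map_smul, smul_eq_mul]
    exact mul_neg_of_pos_of_neg (inv_pos.2 hm) hrneg
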